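/- Let $(r_n)_{n\ge 1}$ be non-negative integers such that $0<2r_n<n$ for all sufficiently large $n$ and $r_n/n^{3/4}\to\infty$. For $x=(x_1,\dots,x_n)\in\mathbb{R}^n$, with the periodic convention $x_{n+k}=x_k$, put $$H_n(x)=-\frac{1}{2r_n}\sum_{i=1}^n\sum_{j=1}^{r_n}x_ix_{i+j},\qquad T_n(x)=\frac{x_1^2+\cdots+x_n^2}{n},\qquad S_n(x)=x_1+\cdots+x_n,$$ and, for such large $n$, let $\mu_n$ be the probability measure on $\mathbb{R}^n$ given by $$d\mu_n(x)=\frac{1}{Z_n}\exp\left(-\frac{H_n(x)}{T_n(x)}\right)\mathbf{1}_{\{T_n(x)>0\}}\prod_{i=1}^n d\nu(x_i),$$ where $\nu$ is the standard normal distribution on $\mathbb{R}$ and $Z_n$ is the normalization constant. Then, under the law $\mu_n$, as $n\to\infty$, $S_n/n^{3/4}$ converges in distribution to the probability measure on $\mathbb{R}$ with density $$\frac{\sqrt2}{\Gamma(1/4)}\exp\left(-\frac{x^4}{4}\right).$$ -/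

import Mathlib

open MeasureTheory ProbabilityTheory Filter Topology
open scoped ENNReal

namespace SpinChain

noncomputable section

/-- The index `i + j` of the periodic chain of `n` sites (indices modulo `n`). -/
def shift {n : ℕ} (i : Fin n) (j : ℕ) : Fin n :=
  ⟨((i : ℕ) + j) % n, Nat.mod_lt _ i.pos⟩

/-- The Hamiltonian `H_n` with interaction range `r` and periodic boundary conditions. -/
def hamiltonian (n r : ℕ) (x : Fin n → ℝ) : ℝ :=
  -(1 / (2 * (r : ℝ))) * ∑ i : Fin n, ∑ j ∈ Finset.Icc 1 r, x i * x (shift i j)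

/-- The self-adjusted temperature `T_n`. -/
def temperature (n : ℕ) (x : Fin n → ℝ) : ℝ :=
  (∑ i : Fin n, x i ^ 2) / n

/-- The magnetization `S_n`. -/
def magnetization (n : ℕ) (x : Fin n → ℝ) : ℝ :=
  ∑ i : Fin n, x i

/-- The law of `n` independent standard normal spins. -/
def freeMeasure (n : ℕ) : Measure (Fin n → ℝ) :=
  Measure.pi fun _ => gaussianReal 0 1

open Classical in
/-- The weight `exp (-H_n / T_n)` times the indicator of `T_n > 0`. -/
def weight (n r : ℕ) (x : Fin n → ℝ) : ℝ≥0∞ :=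
  if 0 < temperature n x then
    ENNReal.ofReal (Real.exp (-(hamiltonian n r x) / temperature n x))
  else 0

/-- The normalization constant `Z_n`. -/
def partitionFunction (n r : ℕ) : ℝ≥0∞ :=
  ∫⁻ x, weight n r x ∂(freeMeasure n)

/-- The spin model `μ_n` with interaction range `r`. -/
def spinMeasure (n r : ℕ) : Measure (Fin n → ℝ) :=
  (partitionFunction n r)⁻¹ • (freeMeasure n).withDensity (weight n r)

/-- The measure on `ℝ` with density `(√2 / Γ(1/4)) exp (-x⁴ / 4)`. -/
def quarticLaw : Measure ℝ :=
  volume.withDensity fun x =>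
    ENNReal.ofReal (Real.sqrt 2 / Real.Gamma (1 / 4) * Real.exp (-(x ^ 4) / 4))

instance (n : ℕ) : IsProbabilityMeasure (freeMeasure n) := by
  unfold freeMeasure; infer_instance

theorem measurable_weight (n r : ℕ) : Measurable (weight n r) := by
  have hT : Measurable (temperature n) := by unfold temperature; fun_prop
  have hH : Measurable (hamiltonian n r) := by unfold hamiltonian; fun_prop
  unfold weight
  exact Measurable.ite (measurableSet_lt measurable_const hT) (by fun_prop) measurable_const

theorem weight_le (n r : ℕ) (x : Fin n → ℝ) :
    weight n r x ≤ ENNReal.ofReal (Real.exp ((n : ℝ) ^ 2 / 2)) := by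
  unfold weight
  split_ifs with h
  · apply ENNReal.ofReal_le_ofReal
    apply Real.exp_le_exp.2
    rw [div_le_iff₀ h]
    have hn : (n : ℝ) ≠ 0 := by
      rintro hn
      simp [temperature, hn] at h
    set s := ∑ i : Fin n, x i ^ 2 with hs
    have hsT : s = n * temperature n x := by
      unfold temperature; rw [← hs]; field_simp
    have hs0 : 0 ≤ s := Finset.sum_nonneg fun i _ => sq_nonneg _
    have hsq : ∀ i, x i ^ 2 ≤ s := fun i =>
      Finset.single_le_sum (f := fun i => x i ^ 2) (fun i _ => sq_nonneg _) (Finset.mem_univ i)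
    have hxy : ∀ i k, x i * x k ≤ s := fun i k => by
      nlinarith [hsq i, hsq k, sq_nonneg (x i - x k)]
    have hsum : ∑ i : Fin n, ∑ j ∈ Finset.Icc 1 r, x i * x (shift i j) ≤ n * (r * s) := by
      calc _ ≤ ∑ i : Fin n, ∑ j ∈ Finset.Icc 1 r, s :=
            Finset.sum_le_sum fun i _ => Finset.sum_le_sum fun j _ => hxy _ _
        _ = n * (r * s) := by simp
    unfold hamiltonian
    rcases Nat.eq_zero_or_pos r with rfl | hr
    · simp; positivity
    · have hr' : (0 : ℝ) < r := by exact_mod_cast hr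
      calc _ = (1 / (2 * (r : ℝ))) *
              ∑ i : Fin n, ∑ j ∈ Finset.Icc 1 r, x i * x (shift i j) := by ring
        _ ≤ (1 / (2 * (r : ℝ))) * (n * (r * s)) :=
            mul_le_mul_of_nonneg_left hsum (by positivity)
        _ = (n : ℝ) ^ 2 / 2 * temperature n x := by rw [hsT]; field_simp
  · exact zero_le

theorem partitionFunction_ne_top (n r : ℕ) : partitionFunction n r ≠ ∞ := by
  refine ((lintegral_mono (weight_le n r)).trans_lt ?_).ne
  simp

theorem partitionFunction_ne_zero (n r : ℕ) [NeZero n] : partitionFunction n r ≠ 0 := by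
  intro h
  rw [partitionFunction, lintegral_eq_zero_iff (measurable_weight n r)] at h
  have h0 : ∀ᵐ x ∂(freeMeasure n), x = 0 := by
    filter_upwards [h] with x hx
    by_contra hne
    obtain ⟨i, hi⟩ := Function.ne_iff.1 hne
    have hT : 0 < temperature n x := by
      refine div_pos ?_ (by exact_mod_cast NeZero.pos n)
      exact Finset.sum_pos' (fun i _ => sq_nonneg _)
        ⟨i, Finset.mem_univ i, sq_pos_iff.2 hi⟩
    simp only [weight, hT, if_true, Pi.zero_apply, ENNReal.ofReal_eq_zero] at hx
    exact absurd hx (not_le.2 (Real.exp_pos _))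
  have h1 : freeMeasure n {0} = 0 := by
    have : NullSingletonClass (gaussianReal 0 1) :=
      nullSingletonClass_gaussianReal one_ne_zero
    rw [freeMeasure, Measure.pi_singleton]
    exact Finset.prod_eq_zero (Finset.mem_univ (0 : Fin n)) (measure_singleton _)
  have h2 : ∀ᵐ x ∂(freeMeasure n), x ≠ 0 := by
    rw [ae_iff]; simpa using h1
  obtain ⟨x, hx, hx'⟩ := (h0.and h2).exists
  exact hx' hx

/-- For `n ≥ 1` the spin model is a probability measure. -/
instance (n r : ℕ) [NeZero n] : IsProbabilityMeasure (spinMeasure n r) := by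
  refine ⟨?_⟩
  rw [spinMeasure, Measure.smul_apply, withDensity_apply _ MeasurableSet.univ,
    Measure.restrict_univ, smul_eq_mul]
  exact ENNReal.inv_mul_cancel (partitionFunction_ne_zero n r) (partitionFunction_ne_top n r)

theorem integral_exp_quartic :
    ∫ x : ℝ, Real.exp (-(x ^ 4) / 4) = Real.Gamma (1 / 4) / Real.sqrt 2 := by
  have h1 : ∀ x : ℝ, Real.exp (-(x ^ 4) / 4) = Real.exp (-(1 / 4) * |x| ^ (4 : ℝ)) := fun x => by
    rw [show (4 : ℝ) = ((4 : ℕ) : ℝ) by norm_num, Real.rpow_natCast, Even.pow_abs (by decide)]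
    congr 1; push_cast; ring
  simp_rw [h1]
  rw [integral_comp_abs (f := fun x => Real.exp (-(1 / 4) * x ^ (4 : ℝ))),
    integral_exp_neg_mul_rpow (by norm_num) (by norm_num), Real.Gamma_add_one (by norm_num)]
  have h2 : (1 / 4 : ℝ) ^ (-1 / 4 : ℝ) = Real.sqrt 2 := by
    rw [Real.sqrt_eq_rpow, show (1 / 4 : ℝ) = 2 ^ (-2 : ℝ) by
      rw [Real.rpow_neg (by norm_num)]; norm_num, ← Real.rpow_mul (by norm_num)]
    norm_num
  rw [h2, eq_div_iff (by positivity)]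
  have h3 : Real.sqrt 2 * Real.sqrt 2 = 2 := Real.mul_self_sqrt (by norm_num)
  linear_combination (1 / 2 * Real.Gamma (1 / 4)) * h3

/-- The limiting law is a probability measure. -/
instance : IsProbabilityMeasure quarticLaw := by
  refine ⟨?_⟩
  have hG : 0 < Real.Gamma (1 / 4) := Real.Gamma_pos_of_pos (by norm_num)
  have hI : ∫ x : ℝ, Real.sqrt 2 / Real.Gamma (1 / 4) * Real.exp (-(x ^ 4) / 4) = 1 := by
    rw [integral_const_mul, integral_exp_quartic]
    have : Real.sqrt 2 ≠ 0 := by positivity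
    field_simp
  rw [quarticLaw, withDensity_apply _ MeasurableSet.univ, Measure.restrict_univ,
    ← ofReal_integral_eq_lintegral_ofReal (integrable_of_integral_eq_one hI)
      (Eventually.of_forall fun x => by positivity), hI, ENNReal.ofReal_one]

end

end SpinChain

open scoped BoundedContinuousFunction

namespace SpinChain

/-! The weight is homogeneous of degree 0. Under the spin measure the norm of the configuration is
therefore independent of its direction and distributed as for free spins (`spinMeasure_normSq_mem`).
So T_n tends to 1 in probability, S_n / n^(3/4) is `directionMagnetization` times √T_n, and by
Slutsky only the direction matters.

The orthogonal Hartley matrix diagonalizes the interaction. With n = d + 1 and eigenvalues 1 and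
l_k, the weight becomes exp(n R / 2), where R is the Rayleigh quotient of y = (y₀, z), and S_n = √n
y₀. Put v = y₀ / |z|, q = (∑ l_k z_k²) / |z|² and θ = 1 / (1 + v²), so that R = v² / (1 + v²) + θ q.
Under a standard Gaussian, v is independent of the direction of z and has density proportional to (1
+ v²)^(-n/2). In the scale s = n^(1/4) v, the factor free of q is ((1 - w) e^w)^(n/2) with w = v² /
(1 + v²). The linear terms of the logarithm cancel, and the quadratic one leaves exp(-s⁴/4)
(`tendsto_slopeDensity`).

It remains to see that the factor with q has no effect in the limit. Relative to the direction of a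
Gaussian with precisions 1 - l_k, the uniform direction of z has density proportional to (1 -
q)^(d/2). This nearly cancels exp(n θ q / 2) when 1 - θ = O(n^(-1/2)) and √n q is small
(`tendsto_tiltMass`). Chebyshev gives the latter once ∑ l_k/(1 - l_k) = o(√n) and ∑ (l_k/(1 - l_k))²
= o(n), while ∑ l_k = -1 supplies uniform bounds for dominated convergence.

The two spectral sums are O((n/r)²) and O((n/r)⁴), by a gap estimate at low frequencies together
with ∑ λ_k² = n/(2r). The assumption r / n^(3/4) → ∞ says precisely that (n/r)² = o(√n). Normalizing
constants are never compared: the test function 1 fixes them. -/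

theorem lintegral_comp_mul_right (f : ℝ → ℝ≥0∞) (hf : Measurable f) {a : ℝ} (ha : a ≠ 0) :
    ∫⁻ x, f (x * a) = ENNReal.ofReal |a⁻¹| * ∫⁻ x, f x := by
  rw [← lintegral_map hf (g := (· * a)) (by fun_prop), Real.map_volume_mul_right ha, lintegral_smul_measure, smul_eq_mul]

/-! ### Polar coordinates and homogeneous functions -/

section Polar

variable {E : Type*} [NormedAddCommGroup E] [NormedSpace ℝ E] [MeasurableSpace E] [BorelSpace E]
  [FiniteDimensional ℝ E] [Nontrivial E]

theorem lintegral_polar (μ : Measure E) [μ.IsAddHaarMeasure] (f : E → ℝ≥0∞) (hf : Measurable f) :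
    ∫⁻ x, f x ∂μ = ∫⁻ w : Metric.sphere (0 : E) 1, (∫⁻ t in Set.Ioi (0 : ℝ),
      ENNReal.ofReal (t ^ (Module.finrank ℝ E - 1)) * f (t • (w : E))) ∂μ.toSphere := by
  have h1 : ∫⁻ x, f x ∂μ = ∫⁻ x : ({(0)}ᶜ : Set E), f x ∂(μ.comap (↑)) := by
    rw [lintegral_subtype_comap (measurableSet_singleton _).compl, restrict_compl_singleton]
  have h2 := (μ.measurePreserving_homeomorphUnitSphereProd).symm
    (homeomorphUnitSphereProd E).toMeasurableEquiv
  have h3 := h2.lintegral_comp_emb (MeasurableEquiv.measurableEmbedding _)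
    (fun x : ({(0)}ᶜ : Set E) => f x)
  rw [h1, ← h3, lintegral_prod]
  · refine lintegral_congr fun w => ?_
    rw [Measure.volumeIoiPow, lintegral_withDensity_eq_lintegral_mul]
    · simp only [Pi.mul_apply]
      rw [← lintegral_subtype_comap measurableSet_Ioi
        (fun t : ℝ => ENNReal.ofReal (t ^ (Module.finrank ℝ E - 1)) * f (t • (w : E)))]
      rfl
    · fun_prop
    · exact hf.comp (by
        refine measurable_subtype_coe.comp ((MeasurableEquiv.measurable _).comp ?_)
        fun_prop)
  · exact (hf.comp (measurable_subtype_coe.comp (MeasurableEquiv.measurable _))).aemeasurable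

/-- On the ray through `w` the substitution `t ↦ t / N w` makes the radial integral independent of
`w`, at the cost of a factor `(N w)⁻¹` to the power of the dimension. The function `N` need not be a
norm: it may vanish wherever `h` does. -/
theorem lintegral_homogeneous (μ : Measure E) [μ.IsAddHaarMeasure] (h : E → ℝ≥0∞)
    (hh : Measurable h) (h0 : ∀ t : ℝ, 0 < t → ∀ x, h (t • x) = h x)
    (N : E → ℝ) (hN : Measurable N) (N1 : ∀ t : ℝ, 0 < t → ∀ x, N (t • x) = t * N x)
    (hpos : ∀ x, h x = 0 ∨ 0 < N x) (φ : ℝ → ℝ≥0∞) (hφ : Measurable φ) :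
    ∫⁻ x, h x * φ (N x) ∂μ =
      (∫⁻ t in Set.Ioi (0 : ℝ), ENNReal.ofReal (t ^ (Module.finrank ℝ E - 1)) * φ t) *
      ∫⁻ w : Metric.sphere (0 : E) 1, h w * ENNReal.ofReal ((N w)⁻¹ ^ Module.finrank ℝ E)
        ∂μ.toSphere := by
  have hD : 0 < Module.finrank ℝ E := Module.finrank_pos
  rw [lintegral_polar μ _ (by fun_prop), ← lintegral_const_mul _ (by fun_prop)]
  refine lintegral_congr fun w => ?_
  rcases hpos w with hw | hw
  · simp only [hw, zero_mul, mul_zero]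
    rw [setLIntegral_congr_fun (g := fun _ => 0) measurableSet_Ioi]
    · simp
    · intro t ht; simp [h0 t ht, hw]
  set a := N w with ha
  have e1 : ∫⁻ t in Set.Ioi (0 : ℝ), ENNReal.ofReal (t ^ (Module.finrank ℝ E - 1)) *
      (h (t • (w : E)) * φ (N (t • (w : E)))) =
      ∫⁻ t in Set.Ioi (0 : ℝ), (h w * ENNReal.ofReal (a⁻¹ ^ (Module.finrank ℝ E - 1))) *
        (ENNReal.ofReal ((t * a) ^ (Module.finrank ℝ E - 1)) * φ (t * a)) := by
    refine setLIntegral_congr_fun measurableSet_Ioi fun t ht => ?_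
    have ht : 0 < t := ht
    rw [h0 t ht, N1 t ht, ← ha, mul_pow, ENNReal.ofReal_mul (by positivity)]
    have : ENNReal.ofReal (a⁻¹ ^ (Module.finrank ℝ E - 1)) *
        ENNReal.ofReal (a ^ (Module.finrank ℝ E - 1)) = 1 := by
      rw [← ENNReal.ofReal_mul (by positivity), ← mul_pow, inv_mul_cancel₀ hw.ne', one_pow,
        ENNReal.ofReal_one]
    calc _ = 1 * (ENNReal.ofReal (t ^ (Module.finrank ℝ E - 1)) * (h w * φ (t * a))) := by ring
      _ = _ := by rw [← this]; ring
  rw [e1, lintegral_const_mul _ (by fun_prop)]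
  set g : ℝ → ℝ≥0∞ := (Set.Ioi (0 : ℝ)).indicator
    (fun t => ENNReal.ofReal (t ^ (Module.finrank ℝ E - 1)) * φ t) with hg
  have hgm : Measurable g := by
    rw [hg]; exact Measurable.indicator (by fun_prop) measurableSet_Ioi
  have e2 : ∫⁻ t in Set.Ioi (0 : ℝ),
      (ENNReal.ofReal ((t * a) ^ (Module.finrank ℝ E - 1)) * φ (t * a)) = ∫⁻ t, g (t * a) := by
    rw [← lintegral_indicator measurableSet_Ioi]
    refine lintegral_congr fun t => ?_
    by_cases ht : 0 < t
    · rw [Set.indicator_of_mem (show t ∈ Set.Ioi 0 from ht), hg, Set.indicator_of_mem (show t * a ∈ Set.Ioi 0 from mul_pos ht hw)]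
    · rw [Set.indicator_of_notMem (show t ∉ Set.Ioi 0 from ht), hg, Set.indicator_of_notMem]
      exact fun h => ht (pos_of_mul_pos_left h hw.le)
  rw [e2, lintegral_comp_mul_right g hgm hw.ne', hg, lintegral_indicator measurableSet_Ioi,
    abs_of_pos (inv_pos.2 hw)]
  have : ENNReal.ofReal (a⁻¹ ^ Module.finrank ℝ E) =
      ENNReal.ofReal (a⁻¹ ^ (Module.finrank ℝ E - 1)) * ENNReal.ofReal a⁻¹ := by
    rw [← ENNReal.ofReal_mul (by positivity), ← pow_succ, Nat.sub_add_cancel hD]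
  rw [this]
  ring

/-- Changing the radial profile in the integral of a function that is homogeneous of degree `0`. -/
theorem lintegral_change_profile (μ : Measure E) [μ.IsAddHaarMeasure] (h : E → ℝ≥0∞)
    (hh : Measurable h) (h0 : ∀ t : ℝ, 0 < t → ∀ x, h (t • x) = h x)
    (N : E → ℝ) (hN : Measurable N) (N1 : ∀ t : ℝ, 0 < t → ∀ x, N (t • x) = t * N x)
    (M : E → ℝ) (hM : Measurable M) (M1 : ∀ t : ℝ, 0 < t → ∀ x, M (t • x) = t * M x)
    (hpos : ∀ x, h x = 0 ∨ (0 < N x ∧ 0 < M x))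
    (φ ψ : ℝ → ℝ≥0∞) (hφ : Measurable φ) (hψ : Measurable ψ) :
    (∫⁻ t in Set.Ioi (0 : ℝ), ENNReal.ofReal (t ^ (Module.finrank ℝ E - 1)) * φ t) *
      ∫⁻ x, h x * ENNReal.ofReal ((M x / N x) ^ Module.finrank ℝ E) * ψ (M x) ∂μ =
    (∫⁻ t in Set.Ioi (0 : ℝ), ENNReal.ofReal (t ^ (Module.finrank ℝ E - 1)) * ψ t) *
      ∫⁻ x, h x * φ (N x) ∂μ := by
  rw [lintegral_homogeneous μ h hh h0 N hN N1 (fun x => (hpos x).imp_right And.left) φ hφ,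
    lintegral_homogeneous μ (fun x => h x * ENNReal.ofReal ((M x / N x) ^ Module.finrank ℝ E))
      (by fun_prop) ?_ M hM M1 ?_ ψ hψ, ← mul_assoc, ← mul_assoc, mul_comm (lintegral _ _)]
  · congr 1
    refine lintegral_congr fun w => ?_
    rcases hpos w with hw | ⟨hw1, hw2⟩
    · simp [hw]
    · rw [mul_assoc, ← ENNReal.ofReal_mul (by positivity), ← mul_pow]
      congr 3
      field_simp
  · intro t ht x
    rw [h0 t ht, N1 t ht, M1 t ht, mul_div_mul_left _ _ ht.ne']
  · intro x
    rcases hpos x with hx | hx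
    · simp [hx]
    · exact Or.inr hx.2

end Polar

/-! ### Products of Gaussians as Lebesgue densities -/

theorem setLIntegral_pi_prod_ofReal {ι : Type*} [Fintype ι] (g : ι → ℝ → ℝ)
    (hg : ∀ i, Integrable (g i)) (hg0 : ∀ i x, 0 ≤ g i x) (s : ι → Set ℝ)
    (hs : ∀ i, MeasurableSet (s i)) :
    ∫⁻ x in Set.univ.pi s, ENNReal.ofReal (∏ i, g i (x i)) =
      ∏ i, ∫⁻ x in s i, ENNReal.ofReal (g i x) := by
  have hi : ∀ i, Integrable ((s i).indicator (g i)) := fun i => (hg i).indicator (hs i)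
  have h0 : ∀ i x, 0 ≤ (s i).indicator (g i) x := fun i x =>
    Set.indicator_nonneg (fun x _ => hg0 i x) x
  have hP : Integrable (fun x : ι → ℝ => ∏ i, (s i).indicator (g i) (x i)) volume :=
    Integrable.fintype_prod hi
  have e1 : ∀ i, ∫⁻ x in s i, ENNReal.ofReal (g i x) =
      ENNReal.ofReal (∫ x, (s i).indicator (g i) x) := fun i => by
    rw [ofReal_integral_eq_lintegral_ofReal (hi i) (Eventually.of_forall (h0 i)),
      ← lintegral_indicator (hs i)]
    refine lintegral_congr fun x => ?_
    by_cases hx : x ∈ s i <;> simp [hx]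
  simp_rw [e1]
  rw [← ENNReal.ofReal_prod_of_nonneg (fun i _ => integral_nonneg (h0 i)),
    ← integral_fintype_prod_volume_eq_prod,
    ofReal_integral_eq_lintegral_ofReal hP
      (Eventually.of_forall fun x => Finset.prod_nonneg fun i _ => h0 i _),
    ← lintegral_indicator (MeasurableSet.univ_pi hs)]
  refine lintegral_congr fun x => ?_
  by_cases hx : x ∈ Set.univ.pi s
  · rw [Set.indicator_of_mem hx]
    congr 1
    exact Finset.prod_congr rfl fun i _ => (Set.indicator_of_mem (hx i trivial) _).symm
  · rw [Set.indicator_of_notMem hx]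
    simp only [Set.mem_univ_pi, not_forall] at hx
    obtain ⟨i, hi⟩ := hx
    rw [Finset.prod_eq_zero (Finset.mem_univ i) (Set.indicator_of_notMem hi _), ENNReal.ofReal_zero]

theorem pi_gaussianReal_eq_withDensity {ι : Type*} [Fintype ι] (v : ι → NNReal)
    (hv : ∀ i, v i ≠ 0) :
    Measure.pi (fun i => gaussianReal 0 (v i)) =
      volume.withDensity (fun x => ENNReal.ofReal (∏ i, gaussianPDFReal 0 (v i) (x i))) := by
  refine Measure.pi_eq fun s hs => ?_
  rw [withDensity_apply _ (MeasurableSet.univ_pi hs), setLIntegral_pi_prod_ofReal _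
    (fun i => integrable_gaussianPDFReal 0 (v i)) (fun i x => gaussianPDFReal_nonneg _ _ _) s hs]
  refine Finset.prod_congr rfl fun i _ => ?_
  rw [gaussianReal_apply _ (hv i)]
  rfl

/-- Integrals against a product of centred Gaussians, as Lebesgue integrals. -/
theorem lintegral_pi_gaussianReal {ι : Type*} [Fintype ι] (v : ι → NNReal)
    (hv : ∀ i, v i ≠ 0) (F : (ι → ℝ) → ℝ≥0∞) :
    ∫⁻ x, F x ∂(Measure.pi fun i => gaussianReal 0 (v i)) =
      ENNReal.ofReal (∏ i, (√(2 * Real.pi * v i))⁻¹) *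
        ∫⁻ x, F x * ENNReal.ofReal (Real.exp (-(∑ i, x i ^ 2 / v i) / 2)) := by
  have hm : Measurable fun x : ι → ℝ => ENNReal.ofReal (∏ i, gaussianPDFReal 0 (v i) (x i)) := by
    refine ENNReal.measurable_ofReal.comp (Finset.measurable_prod _ fun i _ => ?_)
    exact (measurable_gaussianPDFReal 0 (v i)).comp (measurable_pi_apply i)
  rw [pi_gaussianReal_eq_withDensity v hv, lintegral_withDensity_eq_lintegral_mul_non_measurable _ hm
    (Eventually.of_forall fun x => ENNReal.ofReal_lt_top), ← lintegral_const_mul' _ _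
    ENNReal.ofReal_ne_top]
  refine lintegral_congr fun x => ?_
  simp only [Pi.mul_apply, gaussianPDFReal, Finset.prod_mul_distrib, sub_zero]
  rw [ENNReal.ofReal_mul (Finset.prod_nonneg fun i _ => by positivity), ← Real.exp_sum]
  have : ∑ i, -x i ^ 2 / (2 * (v i : ℝ)) = -(∑ i, x i ^ 2 / v i) / 2 := by
    rw [← Finset.sum_neg_distrib, Finset.sum_div]
    refine Finset.sum_congr rfl fun i _ => ?_
    have : (v i : ℝ) ≠ 0 := by exact_mod_cast hv i
    field_simp
  rw [this]
  ring

theorem radial_gaussian_integral_pos (m : ℕ) :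
    (∫⁻ t in Set.Ioi (0 : ℝ), ENNReal.ofReal (t ^ m) * ENNReal.ofReal (Real.exp (-t ^ 2 / 2))) ≠ 0 := by
  intro h
  rw [lintegral_eq_zero_iff (by fun_prop), Filter.EventuallyEq, ae_restrict_iff' measurableSet_Ioi] at h
  have h2 : volume (Set.Ioi (0 : ℝ)) = 0 := by
    refine measure_mono_null (fun t ht => ?_) h
    have ht : 0 < t := ht
    simp only [Set.mem_compl_iff, Set.mem_ofPred_eq, Classical.not_imp]
    refine ⟨ht, ?_⟩
    rw [← ENNReal.ofReal_mul (by positivity)]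
    exact (ENNReal.ofReal_pos.2 (by positivity)).ne'
  simp at h2

theorem radial_gaussian_integral_ne_top (m : ℕ) :
    (∫⁻ t in Set.Ioi (0 : ℝ), ENNReal.ofReal (t ^ m) * ENNReal.ofReal (Real.exp (-t ^ 2 / 2))) ≠ ∞ := by
  have h := integrable_rpow_mul_exp_neg_mul_sq (b := 1 / 2) (by norm_num) (s := m)
    (by have : (0 : ℝ) ≤ m := m.cast_nonneg
        linarith)
  have h2 := (h.restrict (s := Set.Ioi 0)).lintegral_lt_top
  refine ne_of_lt (lt_of_le_of_lt (le_of_eq ?_) h2)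
  refine setLIntegral_congr_fun measurableSet_Ioi fun t ht => ?_
  have ht : 0 < t := ht
  rw [← ENNReal.ofReal_mul (by positivity), Real.rpow_natCast]
  congr 3
  ring

/-! ### Diagonal quadratic forms and directions of Gaussian vectors -/

/-- The squared Euclidean norm. -/
noncomputable def normSq {ι : Type*} [Fintype ι] (z : ι → ℝ) : ℝ := ∑ k, z k ^ 2

/-- The diagonal quadratic form with coefficients `a`. -/
noncomputable def diagForm {ι : Type*} [Fintype ι] (a : ι → ℝ) (z : ι → ℝ) : ℝ :=
  ∑ k, a k * z k ^ 2

section Forms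

variable {ι : Type*} [Fintype ι] {a : ι → ℝ} {z : ι → ℝ}

@[fun_prop]
theorem measurable_normSq : Measurable (normSq : (ι → ℝ) → ℝ) := by unfold normSq; fun_prop

@[fun_prop]
theorem measurable_diagForm (a : ι → ℝ) : Measurable (diagForm a) := by unfold diagForm; fun_prop

theorem normSq_nonneg (z : ι → ℝ) : 0 ≤ normSq z := Finset.sum_nonneg fun _ _ => sq_nonneg _

theorem normSq_smul (t : ℝ) (z : ι → ℝ) : normSq (t • z) = t ^ 2 * normSq z := by
  simp [normSq, mul_pow, Finset.mul_sum]

theorem diagForm_smul (a : ι → ℝ) (t : ℝ) (z : ι → ℝ) :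
    diagForm a (t • z) = t ^ 2 * diagForm a z := by
  simp only [diagForm, Finset.mul_sum, Pi.smul_apply, smul_eq_mul]
  exact Finset.sum_congr rfl fun _ _ => by ring

theorem diagForm_pos (ha : ∀ k, 0 < a k) (hz : z ≠ 0) : 0 < diagForm a z := by
  obtain ⟨i, hi⟩ := Function.ne_iff.1 hz
  exact Finset.sum_pos' (fun k _ => mul_nonneg (ha k).le (sq_nonneg _))
    ⟨i, Finset.mem_univ i, mul_pos (ha i) (sq_pos_iff.2 hi)⟩

theorem normSq_eq_diagForm (z : ι → ℝ) : normSq z = diagForm (fun _ => 1) z := by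
  simp [normSq, diagForm]

theorem normSq_pos (hz : z ≠ 0) : 0 < normSq z := by
  rw [normSq_eq_diagForm]; exact diagForm_pos (fun _ => one_pos) hz

theorem diagForm_one_sub (a : ι → ℝ) (z : ι → ℝ) :
    diagForm (fun k => 1 - a k) z = normSq z - diagForm a z := by
  simp only [diagForm, normSq, ← Finset.sum_sub_distrib]
  exact Finset.sum_congr rfl fun _ _ => by ring

theorem sqrt_sq_mul {t : ℝ} (ht : 0 < t) (x : ℝ) : √(t ^ 2 * x) = t * √x := by
  rw [Real.sqrt_mul (by positivity), Real.sqrt_sq ht.le]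

end Forms

/-- Integrals of functions of the direction against a standard Gaussian, in coordinates in which
the complement of the first axis carries another quadratic form. -/
theorem exists_lintegral_slice {d : ℕ} (hd : d ≠ 0) (a : Fin d → ℝ) (ha : ∀ k, 0 < a k) :
    ∃ C : ℝ≥0∞, C ≠ 0 ∧ C ≠ ∞ ∧ ∀ G : ℝ × (Fin d → ℝ) → ℝ≥0∞, Measurable G →
      (∀ t : ℝ, 0 < t → ∀ y, G (t • y) = G y) →
      ∫⁻ y, G y * ENNReal.ofReal (Real.exp (-(y.1 ^ 2 + normSq y.2) / 2)) =
        C * ∫⁻ v : ℝ, ENNReal.ofReal ((√(1 + v ^ 2))⁻¹ ^ (d + 1)) *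
          ∫⁻ z, G (v * √(normSq z), z) * ENNReal.ofReal ((√(diagForm a z) / √(normSq z)) ^ d) *
            ENNReal.ofReal (Real.exp (-diagForm a z / 2)) := by
  have : Nonempty (Fin d) := ⟨⟨0, Nat.pos_of_ne_zero hd⟩⟩
  set A := ∫⁻ t in Set.Ioi (0 : ℝ), ENNReal.ofReal (t ^ d) * ENNReal.ofReal (Real.exp (-t ^ 2 / 2))
    with hA
  set B := ∫⁻ t in Set.Ioi (0 : ℝ), ENNReal.ofReal (t ^ (d - 1)) *
    ENNReal.ofReal (Real.exp (-t ^ 2 / 2)) with hB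
  have hA0 := radial_gaussian_integral_pos d
  have hAt := radial_gaussian_integral_ne_top d
  have hB0 := radial_gaussian_integral_pos (d - 1)
  have hBt := radial_gaussian_integral_ne_top (d - 1)
  refine ⟨B⁻¹ * A, mul_ne_zero (ENNReal.inv_ne_zero.2 hBt) hA0,
    ENNReal.mul_ne_top (ENNReal.inv_ne_top.2 hB0) hAt, fun G hG G0 => ?_⟩
  have hfin : Module.finrank ℝ (ℝ × (Fin d → ℝ)) = d + 1 := by
    rw [Module.finrank_prod]; simp [add_comm]
  have : (volume : Measure (ℝ × (Fin d → ℝ))).IsAddHaarMeasure := by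
    rw [Measure.volume_eq_prod]; infer_instance
  have hS : MeasurableSet {y : ℝ × (Fin d → ℝ) | y.2 ≠ 0} :=
    (measurable_snd (measurableSet_singleton (0 : Fin d → ℝ))).compl
  -- The radial variable is changed from the norm of `y` to `√(diagForm a y.2)`. The latter vanishes
  -- on the first axis, which is null and is removed by the indicator.
  have key := lintegral_change_profile (volume : Measure (ℝ × (Fin d → ℝ)))
    ({y : ℝ × (Fin d → ℝ) | y.2 ≠ 0}.indicator G) (hG.indicator hS)
    (fun t ht y => by
      by_cases hy : y.2 = 0
      · rw [Set.indicator_of_notMem (by simp [hy]), Set.indicator_of_notMem (by simp [hy])]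
      · rw [Set.indicator_of_mem (by simp [hy, ht.ne']), Set.indicator_of_mem (by simp [hy]),
          G0 t ht])
    (fun y => √(y.1 ^ 2 + normSq y.2)) (by fun_prop)
    (fun t ht y => by
      rw [← sqrt_sq_mul ht, Prod.smul_fst, Prod.smul_snd, normSq_smul, smul_eq_mul]; congr 1; ring)
    (fun y => √(diagForm a y.2)) (by fun_prop)
    (fun t ht y => by rw [← sqrt_sq_mul ht, Prod.smul_snd, diagForm_smul])
    (fun y => by
      by_cases hy : y.2 = 0
      · exact Or.inl (Set.indicator_of_notMem (by simpa using hy) _)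
      · exact Or.inr ⟨Real.sqrt_pos.2 (add_pos_of_nonneg_of_pos (sq_nonneg _) (normSq_pos hy)),
          Real.sqrt_pos.2 (diagForm_pos ha hy)⟩)
    (fun t => ENNReal.ofReal (Real.exp (-t ^ 2 / 2)))
    -- The extra `1 / t` compensates for dimension `d + 1` against `d`: with `M = √(diagForm a z)`,
    -- integrating out the first coordinate leaves one power of `M` too many.
    (fun t => ENNReal.ofReal (Real.exp (-t ^ 2 / 2) / t)) (by fun_prop) (by fun_prop)
  rw [hfin, Nat.add_sub_cancel, ← hA] at key
  have eB : ∫⁻ t in Set.Ioi (0 : ℝ), ENNReal.ofReal (t ^ d) *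
      ENNReal.ofReal (Real.exp (-t ^ 2 / 2) / t) = B := by
    refine setLIntegral_congr_fun measurableSet_Ioi fun t ht => ?_
    have ht : 0 < t := ht
    rw [← ENNReal.ofReal_mul (by positivity), ← ENNReal.ofReal_mul (by positivity)]
    congr 1
    obtain ⟨e, rfl⟩ := Nat.exists_eq_succ_of_ne_zero hd
    simp only [Nat.succ_eq_add_one, Nat.add_sub_cancel]
    field_simp
    ring
  rw [eB] at key
  have hae : ∀ᵐ y : ℝ × (Fin d → ℝ), y.2 ≠ 0 := by
    rw [ae_iff, Measure.volume_eq_prod]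
    have : {y : ℝ × (Fin d → ℝ) | ¬ y.2 ≠ 0} = Set.univ ×ˢ {0} := by ext y; simp
    rw [this, Measure.prod_prod]
    simp
  have eR : ∫⁻ y, {y : ℝ × (Fin d → ℝ) | y.2 ≠ 0}.indicator G y *
      ENNReal.ofReal (Real.exp (-√(y.1 ^ 2 + normSq y.2) ^ 2 / 2)) =
      ∫⁻ y, G y * ENNReal.ofReal (Real.exp (-(y.1 ^ 2 + normSq y.2) / 2)) := by
    refine lintegral_congr_ae ?_
    filter_upwards [hae] with y hy
    rw [Set.indicator_of_mem (by simpa using hy),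
      Real.sq_sqrt (add_nonneg (sq_nonneg _) (normSq_nonneg _))]
  rw [eR] at key
  have hGi : Measurable ({y : ℝ × (Fin d → ℝ) | y.2 ≠ 0}.indicator G) := hG.indicator hS
  have hsol : ∀ X Y : ℝ≥0∞, A * X = B * Y → Y = B⁻¹ * A * X := fun X Y h => by
    rw [mul_assoc, h, ← mul_assoc, ENNReal.inv_mul_cancel hB0 hBt, one_mul]
  rw [hsol _ _ key]
  congr 1
  rw [Measure.volume_eq_prod, lintegral_prod_symm _ (by fun_prop)]
  have e3 : ∀ z : Fin d → ℝ, z ≠ 0 → ∫⁻ y₀ : ℝ, {y : ℝ × (Fin d → ℝ) | y.2 ≠ 0}.indicator G (y₀, z) *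
      ENNReal.ofReal ((√(diagForm a z) / √(y₀ ^ 2 + normSq z)) ^ (d + 1)) *
      ENNReal.ofReal (Real.exp (-√(diagForm a z) ^ 2 / 2) / √(diagForm a z)) =
      ∫⁻ v : ℝ, ENNReal.ofReal ((√(1 + v ^ 2))⁻¹ ^ (d + 1)) *
        (G (v * √(normSq z), z) * ENNReal.ofReal ((√(diagForm a z) / √(normSq z)) ^ d) *
            ENNReal.ofReal (Real.exp (-diagForm a z / 2))) := by
    intro z hz
    have hs := Real.sqrt_pos.2 (normSq_pos hz)
    have hq := diagForm_pos ha hz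
    set s := √(normSq z) with hsd
    have hs2 : normSq z = s ^ 2 := (Real.sq_sqrt (normSq_nonneg z)).symm
    set M := √(diagForm a z) with hM
    have hMp : 0 < M := Real.sqrt_pos.2 hq
    -- Substitution `y₀ = v * s` at fixed `z`: the slope `v` decouples from the norm of `z`.
    have hcv := lintegral_comp_mul_right (fun y₀ : ℝ =>
      {y : ℝ × (Fin d → ℝ) | y.2 ≠ 0}.indicator G (y₀, z) *
      ENNReal.ofReal ((M / √(y₀ ^ 2 + normSq z)) ^ (d + 1)) *
      ENNReal.ofReal (Real.exp (-M ^ 2 / 2) / M)) (by fun_prop) hs.ne'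
    rw [abs_of_pos (inv_pos.2 hs)] at hcv
    have hsol2 : ∀ X Y : ℝ≥0∞, X = ENNReal.ofReal s⁻¹ * Y → Y = ENNReal.ofReal s * X := by
      intro X Y h
      rw [h, ← mul_assoc, ← ENNReal.ofReal_mul hs.le, mul_inv_cancel₀ hs.ne', ENNReal.ofReal_one,
        one_mul]
    rw [hsol2 _ _ hcv, ← lintegral_const_mul _ (by fun_prop)]
    refine lintegral_congr fun v => ?_
    rw [Set.indicator_of_mem (by simpa using hz), hs2,
      show (v * s) ^ 2 + s ^ 2 = s ^ 2 * (1 + v ^ 2) by ring, sqrt_sq_mul hs]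
    have hw : 0 < √(1 + v ^ 2) := Real.sqrt_pos.2 (by positivity)
    have hd2 : diagForm a z = M ^ 2 := (Real.sq_sqrt hq.le).symm
    rw [hd2]
    have : s * ((M / (s * √(1 + v ^ 2))) ^ (d + 1) * (Real.exp (-M ^ 2 / 2) / M)) =
        (√(1 + v ^ 2))⁻¹ ^ (d + 1) * ((M / s) ^ d * Real.exp (-M ^ 2 / 2)) := by
      simp only [div_pow, mul_pow, inv_pow]
      field_simp
      ring
    have h2 := congrArg ENNReal.ofReal this
    rw [ENNReal.ofReal_mul (by positivity), ENNReal.ofReal_mul (by positivity),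
      ENNReal.ofReal_mul (by positivity), ENNReal.ofReal_mul (by positivity)] at h2
    calc _ = G (v * s, z) * (ENNReal.ofReal s * (ENNReal.ofReal ((M / (s * √(1 + v ^ 2))) ^ (d + 1)) *
          ENNReal.ofReal (Real.exp (-M ^ 2 / 2) / M))) := by ring
      _ = _ := by rw [h2]; ring
  have hz0 : ∀ᵐ z : Fin d → ℝ, z ≠ 0 := by rw [ae_iff]; simp
  rw [lintegral_congr_ae (hz0.mono fun z hz => e3 z hz), lintegral_lintegral_swap (by fun_prop)]
  refine lintegral_congr fun v => ?_
  rw [lintegral_const_mul _ (by fun_prop)]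

/-- The centred Gaussian law with independent coordinates of precision `a k`. -/
noncomputable def precisionGaussian {ι : Type*} [Fintype ι] (a : ι → ℝ) : Measure (ι → ℝ) :=
  Measure.pi fun k => gaussianReal 0 (a k)⁻¹.toNNReal

instance {ι : Type*} [Fintype ι] (a : ι → ℝ) : IsProbabilityMeasure (precisionGaussian a) := by
  unfold precisionGaussian; infer_instance

theorem lintegral_precisionGaussian {ι : Type*} [Fintype ι] {a : ι → ℝ} (ha : ∀ k, 0 < a k)
    (F : (ι → ℝ) → ℝ≥0∞) :
    ∫⁻ z, F z ∂(precisionGaussian a) =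
      ENNReal.ofReal (∏ k, √(a k)) * ENNReal.ofReal (∏ _k : ι, (√(2 * Real.pi))⁻¹) *
        ∫⁻ z, F z * ENNReal.ofReal (Real.exp (-diagForm a z / 2)) := by
  have hv : ∀ k, (a k)⁻¹.toNNReal ≠ 0 := fun k => (Real.toNNReal_pos.2 (inv_pos.2 (ha k))).ne'
  have hc : ∀ k, (((a k)⁻¹.toNNReal : NNReal) : ℝ) = (a k)⁻¹ := fun k =>
    Real.coe_toNNReal _ (inv_pos.2 (ha k)).le
  rw [precisionGaussian, lintegral_pi_gaussianReal _ hv,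
    ← ENNReal.ofReal_mul (Finset.prod_nonneg fun _ _ => Real.sqrt_nonneg _),
    ← Finset.prod_mul_distrib]
  congr 2
  · refine congrArg _ (funext fun k => ?_)
    rw [hc, Real.sqrt_mul (by positivity), Real.sqrt_inv, mul_inv, inv_inv, mul_comm]
  · ext z
    rw [diagForm]
    congr 4
    refine congrArg _ (Finset.sum_congr rfl fun k _ => ?_)
    rw [hc, div_inv_eq_mul, mul_comm]

theorem precisionGaussian_one {n : ℕ} : precisionGaussian (fun _ : Fin n => 1) = freeMeasure n := by
  simp [precisionGaussian, freeMeasure]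

theorem ae_ne_zero {d : ℕ} (hd : d ≠ 0) : ∀ᵐ z : Fin d → ℝ, z ≠ 0 := by
  have : Nonempty (Fin d) := ⟨⟨0, Nat.pos_of_ne_zero hd⟩⟩
  rw [ae_iff]; simp

/-- The ratio of two Gaussian angular densities integrates to the ratio of their normalizations. -/
theorem lintegral_angular_density {d : ℕ} (hd : d ≠ 0) {a : Fin d → ℝ} (ha : ∀ k, 0 < a k) :
    ∫⁻ z, ENNReal.ofReal ((√(diagForm a z) / √(normSq z)) ^ d) ∂(precisionGaussian a) =
      ENNReal.ofReal (∏ k, √(a k)) := by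
  have : Nonempty (Fin d) := ⟨⟨0, Nat.pos_of_ne_zero hd⟩⟩
  have hm : MeasurableSet {z : Fin d → ℝ | z ≠ 0} := (measurableSet_singleton 0).compl
  have h1 := lintegral_precisionGaussian (a := fun _ : Fin d => 1) (fun _ => one_pos) (fun _ => 1)
  have key := lintegral_change_profile (volume : Measure (Fin d → ℝ))
    ({z : Fin d → ℝ | z ≠ 0}.indicator fun _ => 1) (measurable_const.indicator hm)
    (fun t ht z => by
      by_cases hz : z = 0
      · rw [hz, smul_zero]
      · rw [Set.indicator_of_mem (by simp [hz, ht.ne']), Set.indicator_of_mem (by simp [hz])])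
    (fun z => √(normSq z)) (by fun_prop)
    (fun t ht z => by rw [← sqrt_sq_mul ht, normSq_smul])
    (fun z => √(diagForm a z)) (by fun_prop)
    (fun t ht z => by rw [← sqrt_sq_mul ht, diagForm_smul])
    (fun z => by
      by_cases hz : z = 0
      · exact Or.inl (Set.indicator_of_notMem (by simp [hz]) _)
      · exact Or.inr ⟨Real.sqrt_pos.2 (normSq_pos hz), Real.sqrt_pos.2 (diagForm_pos ha hz)⟩)
    (fun t => ENNReal.ofReal (Real.exp (-t ^ 2 / 2)))
    (fun t => ENNReal.ofReal (Real.exp (-t ^ 2 / 2))) (by fun_prop) (by fun_prop)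
  -- Both radial profiles are the same Gaussian one, so the radial integrals cancel.
  rw [ENNReal.mul_right_inj (radial_gaussian_integral_pos _) (radial_gaussian_integral_ne_top _),
    Module.finrank_fin_fun] at key
  have e1 : ∫⁻ z : Fin d → ℝ, {z : Fin d → ℝ | z ≠ 0}.indicator (fun _ => (1 : ℝ≥0∞)) z *
      ENNReal.ofReal ((√(diagForm a z) / √(normSq z)) ^ d) *
      ENNReal.ofReal (Real.exp (-√(diagForm a z) ^ 2 / 2)) =
      ∫⁻ z, ENNReal.ofReal ((√(diagForm a z) / √(normSq z)) ^ d) *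
        ENNReal.ofReal (Real.exp (-diagForm a z / 2)) := by
    refine lintegral_congr_ae ?_
    filter_upwards [ae_ne_zero hd] with z hz
    rw [Set.indicator_of_mem (by simpa using hz), one_mul, Real.sq_sqrt (diagForm_pos ha hz).le]
  have e2 : ∫⁻ z : Fin d → ℝ, {z : Fin d → ℝ | z ≠ 0}.indicator (fun _ => (1 : ℝ≥0∞)) z *
      ENNReal.ofReal (Real.exp (-√(normSq z) ^ 2 / 2)) =
      ∫⁻ z : Fin d → ℝ, 1 * ENNReal.ofReal (Real.exp (-diagForm (fun _ => 1) z / 2)) := by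
    refine lintegral_congr_ae ?_
    filter_upwards [ae_ne_zero hd] with z hz
    rw [Set.indicator_of_mem (by simpa using hz), Real.sq_sqrt (normSq_nonneg _),
      normSq_eq_diagForm]
  rw [e1, e2] at key
  rw [lintegral_precisionGaussian ha, key, mul_assoc]
  simp only [lintegral_const, measure_univ, mul_one, Real.sqrt_one, Finset.prod_const_one,
    ENNReal.ofReal_one, one_mul] at h1
  simp only [one_mul]
  rw [← h1, mul_one]

/-- Under a standard Gaussian the norm is independent of the direction. -/
theorem lintegral_mul_normSq {n : ℕ} (hn : n ≠ 0) (G : (Fin n → ℝ) → ℝ≥0∞) (hG : Measurable G)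
    (G0 : ∀ t : ℝ, 0 < t → ∀ x, G (t • x) = G x) (φ : ℝ → ℝ≥0∞) (hφ : Measurable φ) :
    ∫⁻ x, G x * φ (normSq x) ∂(freeMeasure n) =
      (∫⁻ x, G x ∂(freeMeasure n)) * ∫⁻ x, φ (normSq x) ∂(freeMeasure n) := by
  have : Nonempty (Fin n) := ⟨⟨0, Nat.pos_of_ne_zero hn⟩⟩
  have hm : MeasurableSet {z : Fin n → ℝ | z ≠ 0} := (measurableSet_singleton 0).compl
  -- In polar coordinates the integral is a radial factor times an angular one. Taking `G = 1`, `φ =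
  -- 1` or both then identifies the factors without computing them.
  have key : ∃ S : ((Fin n → ℝ) → ℝ≥0∞) → ℝ≥0∞, ∃ J : (ℝ → ℝ≥0∞) → ℝ≥0∞,
      ∀ G : (Fin n → ℝ) → ℝ≥0∞, Measurable G → (∀ t : ℝ, 0 < t → ∀ x, G (t • x) = G x) →
      ∀ φ : ℝ → ℝ≥0∞, Measurable φ →
        ∫⁻ x, G x * φ (normSq x) ∂(freeMeasure n) = J φ * S G := by
    refine ⟨fun G => ∫⁻ w : Metric.sphere (0 : Fin n → ℝ) 1, {z : Fin n → ℝ | z ≠ 0}.indicator G w *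
        ENNReal.ofReal ((√(normSq (w : Fin n → ℝ)))⁻¹ ^ Module.finrank ℝ (Fin n → ℝ))
          ∂(volume : Measure (Fin n → ℝ)).toSphere,
      fun φ => (ENNReal.ofReal (∏ _k : Fin n, √1) *
        ENNReal.ofReal (∏ _k : Fin n, (√(2 * Real.pi))⁻¹)) *
        ∫⁻ t in Set.Ioi (0 : ℝ), ENNReal.ofReal (t ^ (Module.finrank ℝ (Fin n → ℝ) - 1)) *
          (φ (t ^ 2) * ENNReal.ofReal (Real.exp (-t ^ 2 / 2))), ?_⟩
    intro G hG G0 φ hφ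
    rw [← precisionGaussian_one, lintegral_precisionGaussian (fun _ => one_pos)]
    beta_reduce
    rw [mul_assoc _ _ (lintegral (Measure.toSphere _) _), ← lintegral_homogeneous volume _ (hG.indicator hm) ?_ (fun z => √(normSq z)) (by fun_prop)
      (fun t ht z => by rw [← sqrt_sq_mul ht, normSq_smul]) ?_ (fun t =>
        φ (t ^ 2) * ENNReal.ofReal (Real.exp (-t ^ 2 / 2))) (by fun_prop)]
    · congr 1
      refine lintegral_congr_ae ?_
      filter_upwards [ae_ne_zero hn] with z hz
      rw [Set.indicator_of_mem (by simpa using hz), Real.sq_sqrt (normSq_nonneg _),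
        normSq_eq_diagForm, mul_assoc]
    · intro t ht z
      by_cases hz : z = 0
      · rw [hz, smul_zero]
      · rw [Set.indicator_of_mem (by simp [hz, ht.ne']), Set.indicator_of_mem (by simp [hz]),
          G0 t ht]
    · intro z
      by_cases hz : z = 0
      · exact Or.inl (Set.indicator_of_notMem (by simp [hz]) _)
      · exact Or.inr (Real.sqrt_pos.2 (normSq_pos hz))
  obtain ⟨S, J, h⟩ := key
  have h1 := h (fun _ => 1) measurable_const (fun _ _ _ => rfl) (fun _ => 1) measurable_const
  have h2 := h (fun _ => 1) measurable_const (fun _ _ _ => rfl) φ hφ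
  have h3 := h G hG G0 (fun _ => 1) measurable_const
  simp only [mul_one, one_mul, lintegral_const, measure_univ] at h1 h2 h3
  rw [h G hG G0 φ hφ, h2, h3]
  calc J φ * S G = (J φ * S G) * (J (fun _ => 1) * S (fun _ => 1)) := by rw [← h1, mul_one]
    _ = _ := by ring

/-! ### Concentration of Gaussian quadratic forms -/

theorem memLp_sq_gaussianReal (v : NNReal) :
    MemLp (fun x : ℝ => x ^ 2) 2 (gaussianReal 0 v) := by
  have h := (memLp_id_gaussianReal (μ := 0) (v := v) 4)
  have h2 := h.norm_rpow_div (p := ((4 : NNReal) : ℝ≥0∞)) 2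
  have e : (((4 : NNReal) : ℝ≥0∞) / 2) = 2 := by
    have : ((2 : NNReal) : ℝ≥0∞) = 2 := rfl
    rw [← this, ← ENNReal.coe_div (by norm_num)]
    norm_num
  rw [e] at h2
  refine h2.ae_eq (Eventually.of_forall fun x => ?_)
  simp

theorem integral_sq_gaussianReal (v : NNReal) : ∫ x, x ^ 2 ∂(gaussianReal 0 v) = v := by
  have h := variance_fun_id_gaussianReal (μ := 0) (v := v)
  rwa [variance_of_integral_eq_zero (by fun_prop) (by simp)] at h

/-- Scaling by `√v`. The variance of the squared standard Gaussian stays unevaluated, since only its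
independence of `v` is used. -/
theorem variance_sq_gaussianReal (v : NNReal) :
    Var[fun x => x ^ 2; gaussianReal 0 v] = (v : ℝ) ^ 2 * Var[fun x => x ^ 2; gaussianReal 0 1] := by
  have h : gaussianReal 0 v = (gaussianReal 0 1).map (√(v : ℝ) * ·) := by
    rw [gaussianReal_map_const_mul, mul_zero, mul_one]
    congr 1
    ext
    simp
  rw [h, variance_map (by fun_prop) (by fun_prop), ← variance_const_mul]
  congr 1
  ext x
  simp [mul_pow]

/-- Chebyshev's inequality for a diagonal quadratic form of independent centred Gaussians. -/
theorem precisionGaussian_diagForm_deviation {ι : Type*} [Fintype ι] {a : ι → ℝ}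
    (ha : ∀ k, 0 < a k) (c : ι → ℝ) {t : ℝ} (ht : 0 < t) :
    precisionGaussian a {z | t ≤ |diagForm c z - ∑ k, c k / a k|} ≤
      ENNReal.ofReal (Var[fun x => x ^ 2; gaussianReal 0 1] * (∑ k, (c k / a k) ^ 2) / t ^ 2) := by
  have hc : ∀ k, (((a k)⁻¹.toNNReal : NNReal) : ℝ) = (a k)⁻¹ := fun k =>
    Real.coe_toNNReal _ (inv_pos.2 (ha k)).le
  have hL : ∀ k, MemLp (fun x : ℝ => c k * x ^ 2) 2 (gaussianReal 0 (a k)⁻¹.toNNReal) :=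
    fun k => (memLp_sq_gaussianReal _).const_mul (c k)
  have hL' : ∀ k, MemLp (fun z : ι → ℝ => c k * z k ^ 2) 2 (precisionGaussian a) := fun k =>
    (hL k).comp_measurePreserving (measurePreserving_eval (fun k => gaussianReal 0 (a k)⁻¹.toNNReal) k)
  have hE : ∫ z, diagForm c z ∂(precisionGaussian a) = ∑ k, c k / a k := by
    unfold diagForm
    rw [integral_finsetSum _ fun k _ => (hL' k).integrable one_le_two]
    refine Finset.sum_congr rfl fun k _ => ?_
    rw [precisionGaussian, integral_comp_eval (μ := fun k => gaussianReal 0 (a k)⁻¹.toNNReal)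
      (f := fun x : ℝ => c k * x ^ 2) (hL k).aestronglyMeasurable, integral_const_mul,
      integral_sq_gaussianReal, hc]
    rfl
  have hV : Var[diagForm c; precisionGaussian a] =
      Var[fun x => x ^ 2; gaussianReal 0 1] * ∑ k, (c k / a k) ^ 2 := by
    have h := variance_sum_pi hL
    have e : (∑ k, fun z : ι → ℝ => c k * z k ^ 2) = diagForm c := by
      ext z; simp [diagForm]
    rw [e] at h
    rw [precisionGaussian, h, Finset.mul_sum]
    refine Finset.sum_congr rfl fun k _ => ?_
    rw [variance_const_mul, variance_sq_gaussianReal, hc]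
    ring
  have hM : MemLp (diagForm c) 2 (precisionGaussian a) :=
    memLp_finsetSum (f := fun k (z : ι → ℝ) => c k * z k ^ 2) _ fun k _ => hL' k
  have h := meas_ge_le_variance_div_sq hM ht
  rwa [hE, hV] at h

/-- The factor by which the direction is tilted, relative to the Gaussian with precisions
`1 - l k`. -/
noncomputable def tiltFactor {d : ℕ} (l : Fin d → ℝ) (θ : ℝ) (z : Fin d → ℝ) : ℝ :=
  (√(diagForm (fun k => 1 - l k) z) / √(normSq z)) ^ d *
    Real.exp ((d + 1) / 2 * θ * (diagForm l z / normSq z))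

@[fun_prop]
theorem measurable_tiltFactor {d : ℕ} (l : Fin d → ℝ) (θ : ℝ) : Measurable (tiltFactor l θ) := by
  unfold tiltFactor; fun_prop

/-- The expectation of `tiltFactor`. -/
noncomputable def tiltMass {d : ℕ} (l : Fin d → ℝ) (θ : ℝ) : ℝ≥0∞ :=
  ∫⁻ z, ENNReal.ofReal (tiltFactor l θ z) ∂(precisionGaussian fun k => 1 - l k)

/-! ### Bounds for the tilt of the direction -/

section Tilt

variable {d : ℕ} {l : Fin d → ℝ}

theorem rayleigh_lt_one (hl : ∀ k, l k < 1) (z : Fin d → ℝ) : diagForm l z / normSq z < 1 := by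
  by_cases hz : z = 0
  · simp [hz, normSq]
  · rw [div_lt_one (normSq_pos hz)]
    have := diagForm_pos (a := fun k => 1 - l k) (fun k => sub_pos.2 (hl k)) hz
    rw [diagForm_one_sub] at this
    linarith

theorem sqrt_ratio_eq {z : Fin d → ℝ} (hz : z ≠ 0) :
    √(diagForm (fun k => 1 - l k) z) / √(normSq z) = √(1 - diagForm l z / normSq z) := by
  rw [← Real.sqrt_div' _ (normSq_nonneg z), diagForm_one_sub, sub_div, div_self (normSq_pos hz).ne']

theorem sqrt_ratio_pow_le (hd : d ≠ 0) (z : Fin d → ℝ) :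
    (√(diagForm (fun k => 1 - l k) z) / √(normSq z)) ^ d ≤
      Real.exp (-(d / 2 * (diagForm l z / normSq z))) := by
  by_cases hz : z = 0
  · simp [hz, normSq, hd]
  · rw [sqrt_ratio_eq hz]
    set q := diagForm l z / normSq z
    have h1 : √(1 - q) ≤ Real.exp (-q / 2) := by
      rw [Real.sqrt_le_left (Real.exp_pos _).le, ← Real.exp_nat_mul]
      have := Real.add_one_le_exp (-q)
      refine le_trans (by linarith) (this.trans (le_of_eq ?_))
      congr 1; push_cast; ring
    calc √(1 - q) ^ d ≤ Real.exp (-q / 2) ^ d := pow_le_pow_left₀ (Real.sqrt_nonneg _) h1 d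
      _ = _ := by rw [← Real.exp_nat_mul]; congr 1; ring

/-- Convexity of `exp` interpolates in `θ` between two good endpoints. At `θ = 0` the mean is known
exactly; at `θ = 1` the inequality `1 - q ≤ exp (-q)` absorbs all of the exponent except `q / 2`. -/
theorem tiltFactor_le (hd : d ≠ 0) {θ : ℝ} (h0 : 0 ≤ θ) (h1 : θ ≤ 1) (z : Fin d → ℝ) :
    tiltFactor l θ z ≤ (1 - θ) * (√(diagForm (fun k => 1 - l k) z) / √(normSq z)) ^ d +
      θ * Real.exp (diagForm l z / normSq z / 2) := by
  have hP := sqrt_ratio_pow_le (l := l) hd z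
  unfold tiltFactor
  set q := diagForm l z / normSq z
  set P := (√(diagForm (fun k => 1 - l k) z) / √(normSq z)) ^ d
  have hP0 : 0 ≤ P := by positivity
  have hconv := convexOn_exp.2 (Set.mem_univ (0 : ℝ)) (Set.mem_univ ((d + 1 : ℝ) / 2 * q))
    (sub_nonneg.2 h1) h0 (by ring)
  simp only [smul_eq_mul, mul_zero, zero_add, Real.exp_zero, mul_one] at hconv
  have e : Real.exp (-(d / 2 * q)) * Real.exp ((d + 1 : ℝ) / 2 * q) = Real.exp (q / 2) := by
    rw [← Real.exp_add]; congr 1; ring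
  calc P * Real.exp ((d + 1) / 2 * θ * q)
      = P * Real.exp (θ * ((d + 1) / 2 * q)) := by congr 2; ring
    _ ≤ P * (1 - θ + θ * Real.exp ((d + 1) / 2 * q)) := mul_le_mul_of_nonneg_left hconv hP0
    _ = (1 - θ) * P + θ * (P * Real.exp ((d + 1) / 2 * q)) := by ring
    _ ≤ (1 - θ) * P + θ * (Real.exp (-(d / 2 * q)) * Real.exp ((d + 1) / 2 * q)) := by
        gcongr
    _ = _ := by rw [e]

/-- With `log (1 - q) ≥ -q - 2 q²`, the exponent is at least `-d q² - d (1 - θ) q / 2 + θ q / 2`.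
The hypothesis `hs` says that `1 - θ` is of order `(d + 1)^(-1/2)`, which makes the middle term at
most of order `s² ε`. -/
theorem le_tiltFactor {θ s ε : ℝ} (h0 : 0 ≤ θ) (h1 : θ ≤ 1) (hs : (1 - θ) * √(d + 1) ≤ s ^ 2)
    (hε2 : ε ≤ 1 / 2) {z : Fin d → ℝ} (hz : z ≠ 0)
    (hq : √(d + 1) * |diagForm l z / normSq z| < ε) :
    Real.exp (-(ε ^ 2 + s ^ 2 * ε + ε)) ≤ tiltFactor l θ z := by
  unfold tiltFactor
  rw [sqrt_ratio_eq hz]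
  set q := diagForm l z / normSq z
  set R := √((d : ℝ) + 1) with hR
  have hR2 : R ^ 2 = d + 1 := Real.sq_sqrt (by positivity)
  have hR1 : 1 ≤ R := by
    rw [hR]; exact Real.one_le_sqrt.2 (by have : (0 : ℝ) ≤ d := d.cast_nonneg
                                          linarith)
  have hq0 := abs_nonneg q
  have hqε : |q| ≤ ε := by nlinarith
  have hε0 : 0 ≤ ε := hq0.trans hqε
  have hqle : |q| ≤ 1 / 2 := hqε.trans hε2
  obtain ⟨hql, hqu⟩ := abs_le.1 hqle
  have hsq : Real.exp (-(q + 2 * q ^ 2) / 2) ≤ √(1 - q) := by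
    refine Real.le_sqrt_of_sq_le ?_
    rw [← Real.exp_nat_mul, ← Real.le_log_iff_exp_le (by linarith)]
    have hb := Real.abs_log_sub_add_sum_range_le (x := q) (by linarith) 1
    have hb2 : |q| ^ 2 / (1 - |q|) ≤ q ^ 2 * 2 := by
      rw [div_le_iff₀ (by linarith), sq_abs]
      nlinarith [sq_nonneg q]
    have hb3 := (abs_le.1 hb).1
    simp only [Finset.sum_range_one] at hb3
    norm_num at hb3 hb2 ⊢
    linarith
  calc Real.exp (-(ε ^ 2 + s ^ 2 * ε + ε))
      ≤ Real.exp (d * (-(q + 2 * q ^ 2) / 2) + (d + 1) / 2 * θ * q) := by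
        apply Real.exp_le_exp.2
        have e1 : (d : ℝ) * q ^ 2 ≤ ε ^ 2 := by
          calc (d : ℝ) * q ^ 2 ≤ (R * |q|) ^ 2 := by
                rw [mul_pow, sq_abs, hR2]; nlinarith [sq_nonneg q]
            _ ≤ ε ^ 2 := pow_le_pow_left₀ (by positivity) hq.le 2
        have e2 : (d : ℝ) * (1 - θ) * q ≤ s ^ 2 * ε := by
          calc (d : ℝ) * (1 - θ) * q ≤ (d + 1) * (1 - θ) * |q| := by
                have : 0 ≤ 1 - θ := by linarith
                calc (d : ℝ) * (1 - θ) * q ≤ d * (1 - θ) * |q| := by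
                      gcongr; exact le_abs_self q
                  _ ≤ _ := by gcongr; linarith
            _ = ((1 - θ) * R) * (R * |q|) := by rw [← hR2]; ring
            _ ≤ s ^ 2 * ε := by
                have : 0 ≤ 1 - θ := by linarith
                gcongr
        have e3 : -ε ≤ θ * q := by
          have := abs_le.1 (show |θ * q| ≤ ε by
            rw [abs_mul, abs_of_nonneg h0]; nlinarith)
          exact this.1
        have e4 : 0 ≤ s ^ 2 * ε := by positivity
        nlinarith
    _ = Real.exp (-(q + 2 * q ^ 2) / 2) ^ d * Real.exp ((d + 1) / 2 * θ * q) := by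
        rw [Real.exp_add, Real.exp_nat_mul]
    _ ≤ _ := by gcongr

/-- The mean is `∏ √(1 - l k)`, at most `exp (-(∑ l k) / 2)`. The vanishing trace of the full
interaction matrix, in the form `∑ l k = -1`, keeps it bounded in `d`. -/
theorem tiltMass_zero_le (hd : d ≠ 0) (hl : ∀ k, l k < 1) (hsum : ∑ k, l k = -1) :
    ∫⁻ z, ENNReal.ofReal ((√(diagForm (fun k => 1 - l k) z) / √(normSq z)) ^ d)
      ∂(precisionGaussian fun k => 1 - l k) ≤ ENNReal.ofReal (Real.exp (1 / 2)) := by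
  rw [lintegral_angular_density hd fun k => sub_pos.2 (hl k)]
  apply ENNReal.ofReal_le_ofReal
  calc ∏ k, √(1 - l k) ≤ ∏ k, Real.exp (-l k / 2) := by
        refine Finset.prod_le_prod (fun _ _ => Real.sqrt_nonneg _) fun k _ => ?_
        rw [Real.sqrt_le_left (Real.exp_pos _).le, ← Real.exp_nat_mul]
        have := Real.add_one_le_exp (-l k)
        refine le_trans (by linarith) (this.trans (le_of_eq ?_))
        congr 1; push_cast; ring
    _ = Real.exp (1 / 2) := by
        rw [← Real.exp_sum, ← Finset.sum_div, Finset.sum_neg_distrib, hsum, neg_neg]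

/-- Integrates the convexity bound of `tiltFactor_le`. Off the deviation event the Rayleigh quotient
is below `ε` because `√(d + 1) ≥ 1`; on it, it is still below 1. -/
theorem tiltMass_le (hd : d ≠ 0) (hl : ∀ k, l k < 1) (hsum : ∑ k, l k = -1) {θ : ℝ} (h0 : 0 ≤ θ)
    (h1 : θ ≤ 1) {ε : ℝ} (hε : 0 < ε) :
    tiltMass l θ ≤ ENNReal.ofReal ((1 - θ) * Real.exp (1 / 2) + Real.exp (ε / 2) +
      Real.exp (1 / 2) * (precisionGaussian fun k => 1 - l k).real
        {z | ε ≤ √(d + 1) * |diagForm l z / normSq z|}) := by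
  set ζ := precisionGaussian fun k => 1 - l k with hζ
  set B := {z : Fin d → ℝ | ε ≤ √(d + 1) * |diagForm l z / normSq z|} with hB
  have hBm : MeasurableSet B := measurableSet_le measurable_const (by fun_prop)
  have hpt : ∀ z, ENNReal.ofReal (tiltFactor l θ z) ≤
      ENNReal.ofReal (1 - θ) *
        ENNReal.ofReal ((√(diagForm (fun k => 1 - l k) z) / √(normSq z)) ^ d) +
      (ENNReal.ofReal (Real.exp (ε / 2)) +
        B.indicator (fun _ => ENNReal.ofReal (Real.exp (1 / 2))) z) := by
    intro z
    have e1 : θ * Real.exp (diagForm l z / normSq z / 2) ≤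
        Real.exp (diagForm l z / normSq z / 2) :=
      mul_le_of_le_one_left (Real.exp_pos _).le h1
    have e2 : ENNReal.ofReal (Real.exp (diagForm l z / normSq z / 2)) ≤
        ENNReal.ofReal (Real.exp (ε / 2)) +
        B.indicator (fun _ => ENNReal.ofReal (Real.exp (1 / 2))) z := by
      by_cases hz : z ∈ B
      · rw [Set.indicator_of_mem hz]
        refine le_add_left (ENNReal.ofReal_le_ofReal (Real.exp_le_exp.2 ?_))
        linarith [rayleigh_lt_one hl z]
      · refine le_add_right (ENNReal.ofReal_le_ofReal (Real.exp_le_exp.2 ?_))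
        have hz' : √((d : ℝ) + 1) * |diagForm l z / normSq z| < ε := not_le.1 hz
        have hR1 : 1 ≤ √((d : ℝ) + 1) := Real.one_le_sqrt.2 (by
          have : (0 : ℝ) ≤ d := d.cast_nonneg
          linarith)
        have := le_abs_self (diagForm l z / normSq z)
        nlinarith [abs_nonneg (diagForm l z / normSq z)]
    refine (ENNReal.ofReal_le_ofReal ((tiltFactor_le hd h0 h1 z).trans
      (add_le_add_right e1 _))).trans ?_
    rw [ENNReal.ofReal_add (mul_nonneg (sub_nonneg.2 h1) (by positivity)) (Real.exp_pos _).le,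
      ENNReal.ofReal_mul (sub_nonneg.2 h1)]
    exact add_le_add_right e2 _
  calc tiltMass l θ ≤ _ := lintegral_mono hpt
    _ ≤ ENNReal.ofReal (1 - θ) * ENNReal.ofReal (Real.exp (1 / 2)) +
        (ENNReal.ofReal (Real.exp (ε / 2)) + ENNReal.ofReal (Real.exp (1 / 2)) * ζ B) := by
        rw [lintegral_add_left (by fun_prop), lintegral_const_mul _ (by fun_prop),
          lintegral_add_left (by fun_prop), lintegral_indicator_const hBm, lintegral_const,
          measure_univ, mul_one]
        gcongr
        exact tiltMass_zero_le hd hl hsum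
    _ = _ := by
        have hp : 0 ≤ ζ.real B := measureReal_nonneg
        have h1' := sub_nonneg.2 h1
        rw [ENNReal.ofReal_add (by positivity) (by positivity),
          ENNReal.ofReal_add (by positivity) (by positivity),
          ENNReal.ofReal_mul h1', ENNReal.ofReal_mul (by positivity), add_assoc, measureReal_def,
          ENNReal.ofReal_toReal (measure_ne_top _ _)]

/-- The case `ε = 1`, with the probability bounded by 1. Being uniform in `d` and `θ`, it serves as
the dominating constant in `SpectralConditions.tendsto_lintegral`. -/
theorem tiltMass_le_const (hd : d ≠ 0) (hl : ∀ k, l k < 1) (hsum : ∑ k, l k = -1) {θ : ℝ}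
    (h0 : 0 ≤ θ) (h1 : θ ≤ 1) : tiltMass l θ ≤ ENNReal.ofReal (3 * Real.exp (1 / 2)) := by
  refine (tiltMass_le hd hl hsum h0 h1 one_pos).trans (ENNReal.ofReal_le_ofReal ?_)
  have := measureReal_le_one (μ := precisionGaussian fun k => 1 - l k)
    (s := {z | 1 ≤ √((d : ℝ) + 1) * |diagForm l z / normSq z|})
  nlinarith [Real.exp_pos (1 / 2)]

theorem le_tiltMass (hd : d ≠ 0) {θ s ε : ℝ} (h0 : 0 ≤ θ) (h1 : θ ≤ 1)
    (hs : (1 - θ) * √(d + 1) ≤ s ^ 2) (hε2 : ε ≤ 1 / 2) (hl : ∀ k, l k < 1) :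
    ENNReal.ofReal (Real.exp (-(ε ^ 2 + s ^ 2 * ε + ε)) *
      (1 - (precisionGaussian fun k => 1 - l k).real
        {z | ε ≤ √(d + 1) * |diagForm l z / normSq z|})) ≤ tiltMass l θ := by
  set ζ := precisionGaussian fun k => 1 - l k with hζ
  set B := {z : Fin d → ℝ | ε ≤ √(d + 1) * |diagForm l z / normSq z|} with hB
  have hBm : MeasurableSet B := measurableSet_le measurable_const (by fun_prop)
  have hz0 : ∀ᵐ z ∂ζ, z ≠ 0 := by
    have hac : ζ ≪ volume := by
      rw [hζ, precisionGaussian, pi_gaussianReal_eq_withDensity _ fun k =>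
        (Real.toNNReal_pos.2 (inv_pos.2 (sub_pos.2 (hl k)))).ne']
      exact withDensity_absolutelyContinuous _ _
    exact hac.ae_le (ae_ne_zero hd)
  have h2 : 1 - ζ.real B = ζ.real Bᶜ := by rw [probReal_compl_eq_one_sub hBm]
  rw [h2, ENNReal.ofReal_mul (Real.exp_pos _).le, measureReal_def,
    ENNReal.ofReal_toReal (measure_ne_top _ _), ← lintegral_indicator_const hBm.compl]
  refine lintegral_mono_ae ?_
  filter_upwards [hz0] with z hz
  by_cases hzB : z ∈ B
  · rw [Set.indicator_of_notMem (by simpa using hzB)]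
    exact zero_le
  · rw [Set.indicator_of_mem (by simpa using hzB)]
    exact ENNReal.ofReal_le_ofReal (le_tiltFactor h0 h1 hs hε2 hz (not_le.1 hzB))

end Tilt

/-- The asymptotic conditions on the nontrivial eigenvalues of the interaction matrix. -/
structure SpectralConditions (l : ∀ d : ℕ, Fin d → ℝ) : Prop where
  lt_one : ∀ᶠ d in atTop, ∀ k, l d k < 1
  sum_eq : ∀ᶠ d in atTop, ∑ k, l d k = -1
  tendsto_sum : Tendsto (fun d : ℕ => (∑ k, l d k / (1 - l d k)) / √((d : ℝ) + 1)) atTop (𝓝 0)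
  tendsto_sum_sq : Tendsto (fun d : ℕ => (∑ k, (l d k / (1 - l d k)) ^ 2) / ((d : ℝ) + 1)) atTop
    (𝓝 0)

/-! ### Convergence of the tilt mass -/

namespace SpectralConditions

variable {l : ∀ d : ℕ, Fin d → ℝ}

/-- Under precisions `1 - l k` the numerator has mean `∑ l/(1 - l) = o(√d)` and variance of order `∑
(l/(1 - l))² = o(d)`, while the squared norm is of order `d`. Two Chebyshev bounds therefore control
the quotient on the scale `1/√d`. -/
theorem tendsto_rayleigh (h : SpectralConditions l) {ε : ℝ} (hε : 0 < ε) :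
    Tendsto (fun d : ℕ => (precisionGaussian fun k => 1 - l d k).real
      {z | ε ≤ √(d + 1) * |diagForm (l d) z / normSq z|}) atTop (𝓝 0) := by
  set V := Var[fun x => x ^ 2; gaussianReal 0 1] with hV
  have hV0 : 0 ≤ V := variance_nonneg _ _
  set b : ℕ → ℝ := fun d => ∑ k, l d k / (1 - l d k) with hb
  set c : ℕ → ℝ := fun d => ∑ k, (l d k / (1 - l d k)) ^ 2 with hc
  have hinv : Tendsto (fun d : ℕ => ((d : ℝ) + 1)⁻¹) atTop (𝓝 0) := by
    simpa using tendsto_one_div_add_atTop_nhds_zero_nat (𝕜 := ℝ)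
  have hbound : Tendsto (fun d : ℕ => 16 * V * (2 * ((d : ℝ) + 1)⁻¹ + 2 * (c d / (d + 1)) * ((d : ℝ) + 1)⁻¹) +
      16 * V / ε ^ 2 * (c d / (d + 1))) atTop (𝓝 0) := by
    have := (((hinv.const_mul 2).add (((h.tendsto_sum_sq.const_mul 2).mul hinv))).const_mul (16 * V)).add
      (h.tendsto_sum_sq.const_mul (16 * V / ε ^ 2))
    simpa using this
  refine tendsto_of_tendsto_of_tendsto_of_le_of_le' tendsto_const_nhds hbound
    (Eventually.of_forall fun _ => measureReal_nonneg) ?_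
  have hb1 : ∀ᶠ d : ℕ in atTop, |b d / √(d + 1)| < min (ε / 4) (1 / 8) := by
    have := h.tendsto_sum.abs
    rw [abs_zero] at this
    exact this.eventually_lt_const (by positivity)
  -- The bounds `1/8` and `7` are chosen so that `d + b d - (d + 1)/4` exceeds `(d + 1)/2`: it
  -- suffices that `d/4 - 3/4 - (d + 1)/8 ≥ 0`.
  filter_upwards [h.lt_one, hb1, eventually_ge_atTop 7] with d hl hbd hd
  set R := √((d : ℝ) + 1) with hR
  have hd' : (7 : ℝ) ≤ d := by exact_mod_cast hd
  have hR2 : R ^ 2 = d + 1 := Real.sq_sqrt (by positivity)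
  have hR1 : 1 ≤ R := Real.one_le_sqrt.2 (by linarith)
  have hRpos : 0 < R := by linarith
  rw [abs_div, abs_of_pos hRpos, lt_min_iff, div_lt_iff₀ hRpos, div_lt_iff₀ hRpos] at hbd
  obtain ⟨hbd1, hbd2⟩ := hbd
  have ha : ∀ k, 0 < 1 - l d k := fun k => sub_pos.2 (hl k)
  have e1 : ∀ k, 1 / (1 - l d k) = 1 + l d k / (1 - l d k) := fun k => by
    have := (ha k).ne'
    field_simp
    ring
  have e2 : ∑ k, 1 / (1 - l d k) = d + b d := by
    simp_rw [e1, Finset.sum_add_distrib]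
    simp [hb]
  have e3 : ∑ k, (1 / (1 - l d k)) ^ 2 ≤ 2 * (d + 1) + 2 * c d := by
    calc ∑ k, (1 / (1 - l d k)) ^ 2 ≤ ∑ k, (2 + 2 * (l d k / (1 - l d k)) ^ 2) := by
          refine Finset.sum_le_sum fun k _ => ?_
          rw [e1]
          nlinarith [sq_nonneg (1 - l d k / (1 - l d k))]
      _ = 2 * d + 2 * c d := by
          rw [Finset.sum_add_distrib, ← Finset.mul_sum]
          simp [hc, mul_comm]
      _ ≤ _ := by linarith
  set ζ := precisionGaussian fun k => 1 - l d k
  -- If neither event on the right occurs, then `normSq z > (d + 1)/2` and `|diagForm (l d) z| < ε *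
  -- R / 2`, so the quotient times `R` is below `ε`.
  have hsub : {z | ε ≤ R * |diagForm (l d) z / normSq z|} ⊆
      {z | ((d : ℝ) + 1) / 4 ≤ |diagForm (fun _ => 1) z - ∑ k, 1 / (1 - l d k)|} ∪
      {z | ε * R / 4 ≤ |diagForm (l d) z - ∑ k, l d k / (1 - l d k)|} := by
    intro z hz
    by_contra hcon
    simp only [Set.mem_union, Set.mem_ofPred_eq, not_or, not_le] at hcon hz
    obtain ⟨h1, h2⟩ := hcon
    rw [← normSq_eq_diagForm, e2] at h1
    have h1' := (abs_lt.1 h1).1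
    have hbl := (abs_lt.1 hbd2).1
    have hRn : R ≤ d + 1 := by rw [← hR2]; nlinarith
    have hsq : ((d : ℝ) + 1) / 2 < normSq z := by linarith
    have hq : |diagForm (l d) z| < ε * R / 2 := by
      have h3 : |diagForm (l d) z| ≤ |diagForm (l d) z - b d| + |b d| := by
        simpa using abs_add_le (diagForm (l d) z - b d) (b d)
      have h4 : |diagForm (l d) z - b d| < ε * R / 4 := h2
      linarith
    have hsq0 : 0 < normSq z := by linarith
    rw [abs_div, abs_of_pos hsq0, ← mul_div_assoc, le_div_iff₀ hsq0] at hz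
    have : R * |diagForm (l d) z| < R * (ε * R / 2) := by gcongr
    nlinarith
  have hA1 := precisionGaussian_diagForm_deviation ha (fun _ => 1) (t := ((d : ℝ) + 1) / 4)
    (by positivity)
  have hA2 := precisionGaussian_diagForm_deviation ha (l d) (t := ε * R / 4) (by positivity)
  have hc0 : 0 ≤ c d := Finset.sum_nonneg fun _ _ => sq_nonneg _
  refine ENNReal.toReal_le_of_le_ofReal (by positivity) ?_
  refine (measure_mono hsub).trans ((measure_union_le _ _).trans
    ((add_le_add hA1 hA2).trans ?_))
  rw [← ENNReal.ofReal_add (by positivity) (by positivity)]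
  refine ENNReal.ofReal_le_ofReal (add_le_add ?_ (le_of_eq ?_))
  · calc V * (∑ k, (1 / (1 - l d k)) ^ 2) / (((d : ℝ) + 1) / 4) ^ 2
        ≤ V * (2 * (d + 1) + 2 * c d) / (((d : ℝ) + 1) / 4) ^ 2 := by gcongr
      _ = _ := by field_simp; ring
  · change V * c d / _ = _
    rw [div_pow, mul_pow, hR2]
    field_simp
    ring

/-- For fixed `ε` the bounds `le_tiltMass` and `tiltMass_le` converge as `d → ∞`, since the
deviation probability vanishes and `θ → 1`. Their limits tend to 1 as `ε → 0`. -/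
theorem tendsto_tiltMass (h : SpectralConditions l) (s : ℝ) :
    Tendsto (fun d : ℕ => tiltMass (l d) (1 + s ^ 2 / √((d : ℝ) + 1))⁻¹) atTop (𝓝 1) := by
  set θ : ℕ → ℝ := fun d => (1 + s ^ 2 / √((d : ℝ) + 1))⁻¹ with hθ
  have hR : Tendsto (fun d : ℕ => √((d : ℝ) + 1)) atTop atTop :=
    Real.tendsto_sqrt_atTop.comp (tendsto_atTop_add_const_right _ _ tendsto_natCast_atTop_atTop)
  have hθ1 : Tendsto θ atTop (𝓝 1) := by
    have := ((hR.const_div_atTop (s ^ 2)).const_add 1).inv₀ (by norm_num)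
    simpa using this
  have hRp : ∀ d : ℕ, 0 < √((d : ℝ) + 1) := fun d => Real.sqrt_pos.2 (by positivity)
  have h0 : ∀ d, 0 ≤ θ d := fun d => by have := hRp d; simp only [hθ]; positivity
  have h1 : ∀ d, θ d ≤ 1 := fun d => inv_le_one_of_one_le₀ (by
    have := hRp d
    have : 0 ≤ s ^ 2 / √((d : ℝ) + 1) := by positivity
    linarith)
  have hs : ∀ d : ℕ, (1 - θ d) * √((d : ℝ) + 1) ≤ s ^ 2 := fun d => by
    have hp := hRp d
    set R := √((d : ℝ) + 1)
    have : (1 - θ d) * R = s ^ 2 * θ d := by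
      simp only [hθ]
      field_simp
      ring
    rw [this]
    exact mul_le_of_le_one_right (sq_nonneg _) (h1 d)
  have hfin : ∀ᶠ d in atTop, tiltMass (l d) (θ d) ≠ ∞ := by
    filter_upwards [h.lt_one, h.sum_eq, eventually_ne_atTop 0] with d hl hsum hd
    exact ne_top_of_le_ne_top ENNReal.ofReal_ne_top (tiltMass_le_const hd hl hsum (h0 d) (h1 d))
  suffices Tendsto (fun d => (tiltMass (l d) (θ d)).toReal) atTop (𝓝 1) by
    have h2 := ENNReal.tendsto_ofReal this
    rw [ENNReal.ofReal_one] at h2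
    exact h2.congr' (hfin.mono fun d hd => ENNReal.ofReal_toReal hd)
  rw [tendsto_order]
  constructor
  · intro x hx
    have hlim : Tendsto (fun ε : ℝ => Real.exp (-(ε ^ 2 + s ^ 2 * ε + ε))) (𝓝[>] 0) (𝓝 1) := by
      have : Continuous fun ε : ℝ => Real.exp (-(ε ^ 2 + s ^ 2 * ε + ε)) := by fun_prop
      have h2 := (this.tendsto 0).mono_left (nhdsWithin_le_nhds (s := Set.Ioi 0))
      simpa using h2
    obtain ⟨ε, ⟨hεx, hε2⟩, hε0⟩ := ((hlim.eventually_const_lt hx).and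
      ((eventually_le_nhds (show (0 : ℝ) < 1 / 2 by norm_num)).filter_mono
        nhdsWithin_le_nhds) |>.and self_mem_nhdsWithin).exists
    have hp := ((h.tendsto_rayleigh hε0).const_sub 1).const_mul
      (Real.exp (-(ε ^ 2 + s ^ 2 * ε + ε)))
    rw [sub_zero, mul_one] at hp
    filter_upwards [hp.eventually_const_lt hεx, h.lt_one, eventually_ne_atTop 0, hfin]
      with d hpd hl hd hf
    exact hpd.trans_le ((ENNReal.ofReal_le_iff_le_toReal hf).1
      (le_tiltMass hd (h0 d) (h1 d) (hs d) hε2 hl))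
  · intro x hx
    have hlim : Tendsto (fun ε : ℝ => Real.exp (ε / 2)) (𝓝[>] 0) (𝓝 1) := by
      have : Continuous fun ε : ℝ => Real.exp (ε / 2) := by fun_prop
      have h2 := (this.tendsto 0).mono_left (nhdsWithin_le_nhds (s := Set.Ioi 0))
      simpa using h2
    obtain ⟨ε, hεx, hε0⟩ := ((hlim.eventually_lt_const hx).and self_mem_nhdsWithin).exists
    have hε0 : 0 < ε := hε0
    have hp := (((hθ1.const_sub 1).mul_const (Real.exp (1 / 2))).add_const (Real.exp (ε / 2))).add
      ((h.tendsto_rayleigh hε0).const_mul (Real.exp (1 / 2)))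
    rw [sub_self, zero_mul, zero_add, mul_zero, add_zero] at hp
    filter_upwards [hp.eventually_lt_const hεx, h.lt_one, h.sum_eq, eventually_ne_atTop 0]
      with d hpd hl hsum hd
    refine lt_of_le_of_lt (ENNReal.toReal_le_of_le_ofReal ?_
      (tiltMass_le hd hl hsum (h0 d) (h1 d) hε0)) hpd
    have := sub_nonneg.2 (h1 d)
    have hm : 0 ≤ (precisionGaussian fun k => 1 - l d k).real
      {z | ε ≤ √((d : ℝ) + 1) * |diagForm (l d) z / normSq z|} := measureReal_nonneg
    positivity

end SpectralConditions

/-! ### The mean-field slope density and its quartic limit -/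

/-- The density of the rescaled slope `n ^ (1 / 4) * v` in the mean-field case, `n = d + 1`. -/
noncomputable def slopeDensity (d : ℕ) (s : ℝ) : ℝ :=
  (√(1 + s ^ 2 / √((d : ℝ) + 1)))⁻¹ ^ (d + 1) *
    Real.exp (((d : ℝ) + 1) / 2 * (s ^ 2 / √((d : ℝ) + 1) / (1 + s ^ 2 / √((d : ℝ) + 1))))

@[fun_prop]
theorem measurable_slopeDensity (d : ℕ) : Measurable (slopeDensity d) := by
  unfold slopeDensity; fun_prop

theorem slopeDensity_eq_exp (d : ℕ) (s : ℝ) {w : ℝ}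
    (hw : w = s ^ 2 / √((d : ℝ) + 1) / (1 + s ^ 2 / √((d : ℝ) + 1))) :
    slopeDensity d s = Real.exp (((d : ℝ) + 1) / 2 * (Real.log (1 - w) + w)) := by
  unfold slopeDensity
  rw [← hw]
  have hu : 0 ≤ s ^ 2 / √((d : ℝ) + 1) := by positivity
  set u := s ^ 2 / √((d : ℝ) + 1)
  have hw1 : 1 - w = (1 + u)⁻¹ := by rw [hw]; field_simp; ring
  rw [hw1, ← Real.sqrt_inv, ← Real.exp_log (show 0 < √((1 + u)⁻¹) by positivity),
    Real.log_sqrt (by positivity), ← Real.exp_nat_mul, ← Real.exp_add]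
  congr 1
  push_cast
  ring

theorem log_one_sub_le {w : ℝ} (h0 : 0 ≤ w) (h1 : w < 1) : Real.log (1 - w) ≤ -w - w ^ 2 / 2 := by
  have h := sum_le_hasSum (Finset.range 2) (fun i _ => by positivity)
    (Real.hasSum_pow_div_log_of_abs_lt_one (abs_lt.2 ⟨by linarith, h1⟩))
  norm_num [Finset.sum_range_succ] at h
  linarith

/-- One factor `1 - w` is split off from the power `(d + 1)/2`. It gives decay when `s² / R` is
large, where `w` saturates near 1. The other factors give Gaussian decay in `R * w`, which takes
over when `s² / R` is moderate. -/
theorem slopeDensity_le {d : ℕ} (hd : 3 ≤ d) (s : ℝ) :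
    slopeDensity d s ≤ 4 * Real.exp 1 * (1 + s ^ 2)⁻¹ := by
  rw [slopeDensity_eq_exp d s rfl]
  have hd' : (3 : ℝ) ≤ d := by exact_mod_cast hd
  have hRp : 0 < √((d : ℝ) + 1) := Real.sqrt_pos.2 (by linarith)
  have hR2 : √((d : ℝ) + 1) ^ 2 = d + 1 := Real.sq_sqrt (by linarith)
  set R := √((d : ℝ) + 1)
  have hu : 0 ≤ s ^ 2 / R := by positivity
  have hus : s ^ 2 = R * (s ^ 2 / R) := by field_simp
  set u := s ^ 2 / R
  set w := u / (1 + u) with hw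
  have hw0 : 0 ≤ w := by positivity
  have hw1 : w < 1 := by rw [hw, div_lt_one (by positivity)]; linarith
  have huw : u * (1 - w) = w := by rw [hw]; field_simp; ring
  have hlog := log_one_sub_le hw0 hw1
  -- The assumption `3 ≤ d` is what gives `(d - 1)/4 ≥ (d + 1)/8`.
  have e1 : ((d : ℝ) + 1) / 2 * (Real.log (1 - w) + w) ≤
      Real.log (1 - w) + (1 + -((d + 1) * w ^ 2 / 8)) := by
    have : ((d : ℝ) - 1) / 2 * (Real.log (1 - w) + w) ≤ (d - 1) / 2 * (-(w ^ 2 / 2)) := by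
      apply mul_le_mul_of_nonneg_left (by linarith) (by linarith)
    nlinarith [sq_nonneg w]
  refine (Real.exp_le_exp.2 e1).trans ?_
  rw [Real.exp_add, Real.exp_add, Real.exp_log (by linarith)]
  have e2 : Real.exp (-((d + 1) * w ^ 2 / 8)) ≤ (1 + (d + 1) * w ^ 2 / 8)⁻¹ := by
    rw [Real.exp_neg]
    apply inv_anti₀ (by positivity)
    linarith [Real.add_one_le_exp ((d + 1) * w ^ 2 / 8)]
  have e3 : (1 - w) * (1 + (d + 1) * w ^ 2 / 8)⁻¹ ≤ 4 * (1 + s ^ 2)⁻¹ := by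
    rw [← div_eq_mul_inv, ← div_eq_mul_inv, div_le_div_iff₀ (by positivity) (by positivity), hus]
    have : (1 - w) * (1 + R * u) = 1 - w + R * w := by
      linear_combination R * huw
    rw [this, ← hR2]
    nlinarith [sq_nonneg (R * w - 1), sq_nonneg (R * w)]
  have h1w : 0 ≤ 1 - w := by linarith
  calc (1 - w) * (Real.exp 1 * Real.exp (-((d + 1) * w ^ 2 / 8)))
      ≤ (1 - w) * (Real.exp 1 * (1 + (d + 1) * w ^ 2 / 8)⁻¹) := by gcongr
    _ = Real.exp 1 * ((1 - w) * (1 + (d + 1) * w ^ 2 / 8)⁻¹) := by ring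
    _ ≤ Real.exp 1 * (4 * (1 + s ^ 2)⁻¹) := by gcongr
    _ = _ := by ring

theorem tendsto_sqrt_natCast_add_one : Tendsto (fun d : ℕ => √((d : ℝ) + 1)) atTop atTop :=
  Real.tendsto_sqrt_atTop.comp (tendsto_atTop_add_const_right _ _ tendsto_natCast_atTop_atTop)

/-- To second order `log (1 - w) + w` is `-w²/2`, and `(d + 1) w²` tends to `s⁴`. The cubic
remainder contributes at most `s⁶ / √(d + 1)`. -/
theorem tendsto_slopeDensity (s : ℝ) :
    Tendsto (fun d => slopeDensity d s) atTop (𝓝 (Real.exp (-(s ^ 4) / 4))) := by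
  have hu : Tendsto (fun d : ℕ => s ^ 2 / √((d : ℝ) + 1)) atTop (𝓝 0) :=
    tendsto_sqrt_natCast_add_one.const_div_atTop _
  have hmain : Tendsto (fun d : ℕ => -(s ^ 4 / (1 + s ^ 2 / √((d : ℝ) + 1)) ^ 2) / 4) atTop
      (𝓝 (-(s ^ 4) / 4)) := by
    have := ((tendsto_const_nhds (x := s ^ 4)).div ((hu.const_add 1).pow 2)
      (by norm_num)).neg.div_const 4
    simpa using this
  have herr : Tendsto (fun d : ℕ => s ^ 6 / √((d : ℝ) + 1)) atTop (𝓝 0) :=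
    tendsto_sqrt_natCast_add_one.const_div_atTop _
  have hexp : Tendsto (fun d : ℕ => ((d : ℝ) + 1) / 2 *
      (Real.log (1 - s ^ 2 / √((d : ℝ) + 1) / (1 + s ^ 2 / √((d : ℝ) + 1))) +
        s ^ 2 / √((d : ℝ) + 1) / (1 + s ^ 2 / √((d : ℝ) + 1)))) atTop (𝓝 (-(s ^ 4) / 4)) := by
    refine tendsto_of_tendsto_of_dist hmain (squeeze_zero (fun _ => dist_nonneg) (fun d => ?_) herr)
    have hRp : 0 < √((d : ℝ) + 1) := Real.sqrt_pos.2 (by positivity)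
    have hR2 : √((d : ℝ) + 1) ^ 2 = d + 1 := Real.sq_sqrt (by positivity)
    set R := √((d : ℝ) + 1)
    rw [← hR2]
    have hu : 0 ≤ s ^ 2 / R := by positivity
    have hu4 : s ^ 4 = R ^ 2 * (s ^ 2 / R) ^ 2 := by field_simp
    have hu6 : s ^ 6 / R = R ^ 2 * (s ^ 2 / R) ^ 3 := by field_simp
    set u := s ^ 2 / R
    set w := u / (1 + u) with hw
    have hw0 : 0 ≤ w := by positivity
    have hw1 : w < 1 := by rw [hw, div_lt_one (by positivity)]; linarith
    have hb := Real.abs_log_sub_add_sum_range_le (x := w) (by rwa [abs_of_nonneg hw0]) 2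
    rw [abs_of_nonneg hw0] at hb
    norm_num [Finset.sum_range_succ] at hb
    have hwu : w ^ 3 / (1 - w) ≤ u ^ 3 := by
      have : w ^ 3 / (1 - w) = u ^ 3 / (1 + u) ^ 2 := by
        have h1 : 1 - w = (1 + u)⁻¹ := by rw [hw]; field_simp; ring
        rw [h1, hw]; field_simp
      rw [this]
      exact div_le_self (by positivity) (one_le_pow₀ (by linarith))
    rw [dist_comm, Real.dist_eq, hu4, hu6]
    have e : R ^ 2 / 2 * (Real.log (1 - w) + w) - -(R ^ 2 * u ^ 2 / (1 + u) ^ 2) / 4 =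
        R ^ 2 / 2 * (w + w ^ 2 / 2 + Real.log (1 - w)) := by
      rw [hw]; field_simp; ring
    rw [e, abs_mul, abs_of_nonneg (by positivity)]
    have h3 : 0 ≤ u ^ 3 := by positivity
    calc R ^ 2 / 2 * |w + w ^ 2 / 2 + Real.log (1 - w)| ≤ R ^ 2 / 2 * u ^ 3 := by
          gcongr; exact hb.trans hwu
      _ ≤ R ^ 2 * u ^ 3 := by nlinarith [sq_nonneg R, mul_nonneg (sq_nonneg R) h3]
  refine (((Real.continuous_exp.tendsto _).comp hexp)).congr fun d => ?_
  exact (slopeDensity_eq_exp d s rfl).symm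

@[fun_prop]
theorem measurable_tiltMass {d : ℕ} (l : Fin d → ℝ) : Measurable (tiltMass l) := by
  unfold tiltMass
  refine Measurable.lintegral_prod_right' (f := fun p : ℝ × (Fin d → ℝ) =>
    ENNReal.ofReal (tiltFactor l p.1 p.2)) ?_
  unfold tiltFactor
  fun_prop

/-- Dominated convergence: the slope density is bounded by a multiple of `1 / (1 + s²)`, and `f` and
the tilt mass by constants. -/
theorem SpectralConditions.tendsto_lintegral {l : ∀ d : ℕ, Fin d → ℝ} (h : SpectralConditions l)
    (f : ℝ →ᵇ NNReal) :
    Tendsto (fun d : ℕ => ∫⁻ s, ENNReal.ofReal (slopeDensity d s) *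
        (f (s / √(1 + s ^ 2 / √((d : ℝ) + 1))) * tiltMass (l d) (1 + s ^ 2 / √((d : ℝ) + 1))⁻¹))
      atTop (𝓝 (∫⁻ s, ENNReal.ofReal (Real.exp (-(s ^ 4) / 4)) * f s)) := by
  obtain ⟨M, hM⟩ : ∃ M : NNReal, ∀ x, f x ≤ M := ⟨nndist 0 f, fun x => f.apply_le_nndist_zero x⟩
  refine tendsto_lintegral_filter_of_dominated_convergence
    (fun s => ENNReal.ofReal (4 * Real.exp 1 * (1 + s ^ 2)⁻¹) *
      (M * ENNReal.ofReal (3 * Real.exp (1 / 2)))) ?_ ?_ ?_ ?_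
  · refine Eventually.of_forall fun d => ?_
    have hf : Measurable f := f.continuous.measurable
    fun_prop
  · filter_upwards [h.lt_one, h.sum_eq, eventually_ge_atTop 3] with d hl hsum hd
    refine Eventually.of_forall fun s => ?_
    have hp : 0 ≤ s ^ 2 / √((d : ℝ) + 1) := by positivity
    refine mul_le_mul' (ENNReal.ofReal_le_ofReal (slopeDensity_le hd s)) (mul_le_mul' ?_ ?_)
    · exact_mod_cast hM _
    · exact tiltMass_le_const (by lia) hl hsum (by positivity)
        (inv_le_one_of_one_le₀ (by linarith))
  · rw [lintegral_mul_const _ (by fun_prop)]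
    refine ENNReal.mul_ne_top ?_ (ENNReal.mul_ne_top ENNReal.coe_ne_top ENNReal.ofReal_ne_top)
    exact (integrable_inv_one_add_sq.const_mul _).lintegral_lt_top.ne
  · refine Eventually.of_forall fun s => ?_
    have hu : Tendsto (fun d : ℕ => s ^ 2 / √((d : ℝ) + 1)) atTop (𝓝 0) :=
      tendsto_sqrt_natCast_add_one.const_div_atTop _
    have harg : Tendsto (fun d : ℕ => s / √(1 + s ^ 2 / √((d : ℝ) + 1))) atTop (𝓝 s) := by
      have := (tendsto_const_nhds (x := s)).div (hu.const_add 1).sqrt (by norm_num)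
      simp only [add_zero, Real.sqrt_one, div_one] at this
      exact this
    have h1 := ENNReal.tendsto_ofReal (tendsto_slopeDensity s)
    have h2 : Tendsto (fun d : ℕ => (f (s / √(1 + s ^ 2 / √((d : ℝ) + 1))) : ℝ≥0∞)) atTop (𝓝 (f s)) :=
      ENNReal.tendsto_coe.2 ((f.continuous.tendsto s).comp harg)
    have h3 := h.tendsto_tiltMass s
    have h4 := ENNReal.Tendsto.mul h2 (Or.inr ENNReal.one_ne_top) h3 (Or.inr ENNReal.coe_ne_top)
    rw [mul_one] at h4
    exact ENNReal.Tendsto.mul h1 (Or.inr ENNReal.coe_ne_top) h4 (Or.inr ENNReal.ofReal_ne_top)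

/-! ### Reduction of the direction to the rescaled slope -/

theorem tiltMass_eq_lintegral_volume {d : ℕ} {l : Fin d → ℝ} (hl : ∀ k, l k < 1) :
    ∃ C : ℝ≥0∞, C ≠ 0 ∧ C ≠ ∞ ∧ ∀ θ, ∫⁻ z, ENNReal.ofReal (tiltFactor l θ z) *
      ENNReal.ofReal (Real.exp (-diagForm (fun k => 1 - l k) z / 2)) = C * tiltMass l θ := by
  have h1 : ∏ k, √(1 - l k) > 0 := Finset.prod_pos fun k _ => Real.sqrt_pos.2 (sub_pos.2 (hl k))
  have h2 : ∏ _k : Fin d, (√(2 * Real.pi))⁻¹ > 0 := Finset.prod_pos fun k _ => by positivity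
  have h0 : ENNReal.ofReal (∏ k, √(1 - l k)) * ENNReal.ofReal (∏ _k : Fin d, (√(2 * Real.pi))⁻¹) ≠ 0 :=
    mul_ne_zero (ENNReal.ofReal_pos.2 h1).ne' (ENNReal.ofReal_pos.2 h2).ne'
  have ht : ENNReal.ofReal (∏ k, √(1 - l k)) * ENNReal.ofReal (∏ _k : Fin d, (√(2 * Real.pi))⁻¹) ≠ ∞ :=
    ENNReal.mul_ne_top ENNReal.ofReal_ne_top ENNReal.ofReal_ne_top
  refine ⟨_, ENNReal.inv_ne_zero.2 ht, ENNReal.inv_ne_top.2 h0, fun θ => ?_⟩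
  rw [tiltMass, lintegral_precisionGaussian fun k => sub_pos.2 (hl k), ← mul_assoc,
    ENNReal.inv_mul_cancel h0 ht, one_mul]

/-- The law of the direction, weighted by the exponential of a Rayleigh quotient with eigenvalues
`1` and `l k`, in terms of the rescaled slope. -/
theorem exists_lintegral_direction {d : ℕ} (hd : d ≠ 0) {l : Fin d → ℝ} (hl : ∀ k, l k < 1) :
    ∃ C : ℝ≥0∞, C ≠ 0 ∧ C ≠ ∞ ∧ ∀ f : ℝ → ℝ≥0∞, Measurable f →
      ∫⁻ y : ℝ × (Fin d → ℝ), f (√√((d : ℝ) + 1) * (y.1 / √(y.1 ^ 2 + normSq y.2))) *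
        ENNReal.ofReal (Real.exp (((d : ℝ) + 1) / 2 *
          ((y.1 ^ 2 + diagForm l y.2) / (y.1 ^ 2 + normSq y.2)))) *
        ENNReal.ofReal (Real.exp (-(y.1 ^ 2 + normSq y.2) / 2)) =
      C * ∫⁻ s, ENNReal.ofReal (slopeDensity d s) *
        (f (s / √(1 + s ^ 2 / √((d : ℝ) + 1))) * tiltMass l (1 + s ^ 2 / √((d : ℝ) + 1))⁻¹) := by
  have ha : ∀ k, 0 < 1 - l k := fun k => sub_pos.2 (hl k)
  obtain ⟨C₁, hC₁0, hC₁t, h₁⟩ := exists_lintegral_slice hd (fun k => 1 - l k) ha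
  obtain ⟨C₂, hC₂0, hC₂t, h₂⟩ := tiltMass_eq_lintegral_volume hl
  set ρ := √√((d : ℝ) + 1) with hρ
  have hρ0 : 0 < ρ := Real.sqrt_pos.2 (Real.sqrt_pos.2 (by positivity))
  have hρ2 : ρ ^ 2 = √((d : ℝ) + 1) := Real.sq_sqrt (Real.sqrt_nonneg _)
  refine ⟨C₁ * (C₂ * ENNReal.ofReal ρ⁻¹), mul_ne_zero hC₁0 (mul_ne_zero hC₂0
    (ENNReal.ofReal_pos.2 (by positivity)).ne'),
    ENNReal.mul_ne_top hC₁t (ENNReal.mul_ne_top hC₂t ENNReal.ofReal_ne_top), fun f hf => ?_⟩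
  rw [h₁ (fun y => f (ρ * (y.1 / √(y.1 ^ 2 + normSq y.2))) *
    ENNReal.ofReal (Real.exp (((d : ℝ) + 1) / 2 *
          ((y.1 ^ 2 + diagForm l y.2) / (y.1 ^ 2 + normSq y.2))))) (by fun_prop) ?_, mul_assoc]
  swap
  · intro t ht y
    simp only [Prod.smul_fst, Prod.smul_snd, smul_eq_mul, normSq_smul, diagForm_smul, mul_pow,
      ← mul_add]
    rw [sqrt_sq_mul ht, mul_div_mul_left _ _ ht.ne', mul_div_mul_left _ _ (by positivity)]
  congr 1
  set Φ : ℝ → ℝ≥0∞ := fun v => ENNReal.ofReal ((√(1 + v ^ 2))⁻¹ ^ (d + 1) *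
    Real.exp (((d : ℝ) + 1) / 2 * (v ^ 2 / (1 + v ^ 2)))) *
    (f (ρ * v / √(1 + v ^ 2)) * tiltMass l (1 + v ^ 2)⁻¹) with hΦ
  have hΦm : Measurable Φ := by rw [hΦ]; fun_prop
  have e1 : ∀ v : ℝ, ENNReal.ofReal ((√(1 + v ^ 2))⁻¹ ^ (d + 1)) *
      ∫⁻ z, f (ρ * (v * √(normSq z) / √((v * √(normSq z)) ^ 2 + normSq z))) *
        ENNReal.ofReal (Real.exp (((d : ℝ) + 1) / 2 *
          (((v * √(normSq z)) ^ 2 + diagForm l z) / ((v * √(normSq z)) ^ 2 + normSq z)))) *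
        ENNReal.ofReal ((√(diagForm (fun k => 1 - l k) z) / √(normSq z)) ^ d) *
        ENNReal.ofReal (Real.exp (-diagForm (fun k => 1 - l k) z / 2)) = C₂ * Φ v := by
    intro v
    have hw : 0 < √(1 + v ^ 2) := Real.sqrt_pos.2 (by positivity)
    have e2 : ∀ z : Fin d → ℝ, z ≠ 0 →
        f (ρ * (v * √(normSq z) / √((v * √(normSq z)) ^ 2 + normSq z))) *
        ENNReal.ofReal (Real.exp (((d : ℝ) + 1) / 2 *
          (((v * √(normSq z)) ^ 2 + diagForm l z) / ((v * √(normSq z)) ^ 2 + normSq z)))) *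
        ENNReal.ofReal ((√(diagForm (fun k => 1 - l k) z) / √(normSq z)) ^ d) *
        ENNReal.ofReal (Real.exp (-diagForm (fun k => 1 - l k) z / 2)) =
        (f (ρ * v / √(1 + v ^ 2)) *
          ENNReal.ofReal (Real.exp (((d : ℝ) + 1) / 2 * (v ^ 2 / (1 + v ^ 2))))) *
        (ENNReal.ofReal (tiltFactor l (1 + v ^ 2)⁻¹ z) *
          ENNReal.ofReal (Real.exp (-diagForm (fun k => 1 - l k) z / 2))) := by
      intro z hz
      have hs := Real.sqrt_pos.2 (normSq_pos hz)
      have hs2 : √(normSq z) ^ 2 = normSq z := Real.sq_sqrt (normSq_nonneg z)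
      unfold tiltFactor
      rw [← hs2]
      rw [Real.sqrt_sq hs.le]
      set s := √(normSq z)
      rw [show (v * s) ^ 2 + s ^ 2 = s ^ 2 * (1 + v ^ 2) by ring, sqrt_sq_mul hs]
      have a1 : ρ * (v * s / (s * √(1 + v ^ 2))) = ρ * v / √(1 + v ^ 2) := by field_simp
      -- The Rayleigh quotient splits into a function of the slope and `(1 + v²)⁻¹` times the
      -- quotient of `z` alone, which is how `θ = (1 + v²)⁻¹` enters the tilt.
      have a2 : ((d : ℝ) + 1) / 2 * (((v * s) ^ 2 + diagForm l z) / (s ^ 2 * (1 + v ^ 2))) =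
          ((d : ℝ) + 1) / 2 * (v ^ 2 / (1 + v ^ 2)) +
          ((d : ℝ) + 1) / 2 * (1 + v ^ 2)⁻¹ * (diagForm l z / s ^ 2) := by field_simp
      rw [a1, a2, Real.exp_add, ENNReal.ofReal_mul (by positivity), ENNReal.ofReal_mul (by positivity)]
      ring
    rw [lintegral_congr_ae ((ae_ne_zero hd).mono fun z hz => e2 z hz),
      lintegral_const_mul _ (by fun_prop), h₂, hΦ]
    beta_reduce
    rw [ENNReal.ofReal_mul (by positivity)]
    ring
  simp only [e1]
  rw [lintegral_const_mul _ hΦm, mul_assoc]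
  congr 1
  have hcv := lintegral_comp_mul_right Φ hΦm (inv_ne_zero hρ0.ne')
  rw [inv_inv, abs_of_pos hρ0] at hcv
  -- Rescaling `s = ρ * v` with `ρ = (d + 1)^(1/4)`, the scale on which the slope density has a
  -- limit.
  have e3 : ∫⁻ v, Φ v = ENNReal.ofReal ρ⁻¹ * ∫⁻ s, Φ (s * ρ⁻¹) := by
    rw [hcv, ← mul_assoc, ← ENNReal.ofReal_mul (by positivity), inv_mul_cancel₀ hρ0.ne',
      ENNReal.ofReal_one, one_mul]
  rw [e3]
  congr 1
  refine lintegral_congr fun s => ?_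
  have b1 : (s * ρ⁻¹) ^ 2 = s ^ 2 / √((d : ℝ) + 1) := by
    rw [mul_pow, inv_pow, hρ2, div_eq_mul_inv]
  have b2 : ρ * (s * ρ⁻¹) = s := by field_simp
  simp only [hΦ]
  rw [b1, b2]
  rfl

/-! ### Trigonometric sums and the eigenvalues of the interaction -/

theorem sum_cos_int_mul_add {n : ℕ} {m : ℤ} (hm : ¬ (n : ℤ) ∣ m) (b : ℝ) :
    ∑ i ∈ Finset.range n, Real.cos (2 * Real.pi * m / n * i + b) = 0 := by
  rcases Nat.eq_zero_or_pos n with rfl | hn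
  · simp
  have hn' : (n : ℝ) ≠ 0 := by exact_mod_cast hn.ne'
  rw [Real.sum_cos]
  · have : (n : ℝ) * (2 * Real.pi * m / n) / 2 = m * Real.pi := by field_simp
    rw [this, Real.sin_int_mul_pi, zero_mul, zero_div]
  · intro k hk
    apply hm
    refine ⟨k, ?_⟩
    have : (m : ℝ) = n * k := by
      have hpi := Real.pi_ne_zero
      field_simp at hk
      linarith
    exact_mod_cast this

theorem sum_sin_int_mul (n : ℕ) (m : ℤ) :
    ∑ i ∈ Finset.range n, Real.sin (2 * Real.pi * m / n * i) = 0 := by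
  rcases Nat.eq_zero_or_pos n with rfl | hn
  · simp
  have hn' : (n : ℝ) ≠ 0 := by exact_mod_cast hn.ne'
  by_cases hm : (n : ℤ) ∣ m
  · obtain ⟨c, rfl⟩ := hm
    refine Finset.sum_eq_zero fun i _ => ?_
    have : 2 * Real.pi * ((n * c : ℤ) : ℝ) / n * i = ((2 * c * i : ℤ) : ℝ) * Real.pi := by
      push_cast; field_simp
    rw [this, Real.sin_int_mul_pi]
  · have h := sum_cos_int_mul_add hm (-(Real.pi / 2))
    simpa [← sub_eq_add_neg, Real.cos_sub_pi_div_two] using h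

theorem sum_cos_int_mul {n : ℕ} (hn : n ≠ 0) (m : ℤ) :
    ∑ i ∈ Finset.range n, Real.cos (2 * Real.pi * m / n * i) =
      if (n : ℤ) ∣ m then (n : ℝ) else 0 := by
  have hn' : (n : ℝ) ≠ 0 := by exact_mod_cast hn
  split_ifs with hm
  · obtain ⟨c, rfl⟩ := hm
    have : ∀ i ∈ Finset.range n, Real.cos (2 * Real.pi * ((n * c : ℤ) : ℝ) / n * i) = 1 := by
      intro i _
      have : 2 * Real.pi * ((n * c : ℤ) : ℝ) / n * i = ((c * i : ℤ) : ℝ) * (2 * Real.pi) := by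
        push_cast; field_simp
      rw [this, Real.cos_int_mul_two_pi]
    rw [Finset.sum_congr rfl this]
    simp
  · simpa using sum_cos_int_mul_add hm 0

/-- The `k`-th eigenvalue of the interaction matrix, normalized to be `1` for `k = 0`. -/
noncomputable def eigenvalue (n r k : ℕ) : ℝ :=
  (∑ j ∈ Finset.Icc 1 r, Real.cos (2 * Real.pi * j / n * k)) / r

section Eigenvalue

variable {n r : ℕ}

theorem eigenvalue_zero (hr : r ≠ 0) : eigenvalue n r 0 = 1 := by
  have : (r : ℝ) ≠ 0 := by exact_mod_cast hr
  simp [eigenvalue, this]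

theorem abs_eigenvalue_le (k : ℕ) : |eigenvalue n r k| ≤ 1 := by
  rw [eigenvalue, abs_div, Nat.abs_cast]
  refine div_le_one_of_le₀ ((Finset.abs_sum_le_sum_abs _ _).trans ?_) (Nat.cast_nonneg r)
  calc _ ≤ ∑ _j ∈ Finset.Icc 1 r, (1 : ℝ) := Finset.sum_le_sum fun j _ => Real.abs_cos_le_one _
    _ = r := by simp

theorem eigenvalue_sub {k : ℕ} (hk : k ≤ n) (hn : n ≠ 0) :
    eigenvalue n r (n - k) = eigenvalue n r k := by
  have hn' : (n : ℝ) ≠ 0 := by exact_mod_cast hn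
  unfold eigenvalue
  congr 1
  refine Finset.sum_congr rfl fun j _ => ?_
  have : 2 * Real.pi * j / n * ((n - k : ℕ) : ℝ) = j * (2 * Real.pi) - 2 * Real.pi * j / n * k := by
    rw [Nat.cast_sub hk]; field_simp
  rw [this, Real.cos_nat_mul_two_pi_sub]

/-- The trace of the interaction matrix: its diagonal is zero because no `j` in `1, …, r` is a
multiple of `n`. -/
theorem sum_eigenvalue (h : r < n) : ∑ k ∈ Finset.range n, eigenvalue n r k = 0 := by
  unfold eigenvalue
  rw [← Finset.sum_div, Finset.sum_comm]
  rw [Finset.sum_eq_zero, zero_div]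
  intro j hj
  rw [Finset.mem_Icc] at hj
  have := sum_cos_int_mul (n := n) (by lia) (j : ℤ)
  rw [if_neg] at this
  · simpa using this
  · rw [Int.natCast_dvd_natCast]
    exact Nat.not_dvd_of_pos_of_lt (by lia) (by lia)

/-- The squared Frobenius norm: each site has `2 * r` distinct neighbours with coefficient `1 / (2 *
r)`. In the expansion, `2 * r < n` prevents `j + i` and nonzero `j - i` from being multiples of `n`.
-/
theorem sum_eigenvalue_sq (hr : r ≠ 0) (h : 2 * r < n) :
    ∑ k ∈ Finset.range n, eigenvalue n r k ^ 2 = n / (2 * r) := by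
  have hn : n ≠ 0 := by lia
  have hr' : (r : ℝ) ≠ 0 := by exact_mod_cast hr
  have e : ∀ k ∈ Finset.range n, eigenvalue n r k ^ 2 = (∑ j ∈ Finset.Icc 1 r, ∑ i ∈ Finset.Icc 1 r,
      (Real.cos (2 * Real.pi * ((j - i : ℤ) : ℝ) / n * k) +
        Real.cos (2 * Real.pi * ((j + i : ℤ) : ℝ) / n * k))) / (2 * r ^ 2) := by
    intro k _
    rw [eigenvalue, div_pow, pow_two (Finset.sum _ _), Finset.sum_mul_sum, ← div_div, Finset.sum_div _ _ (2 : ℝ)]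
    congr 1
    refine Finset.sum_congr rfl fun j _ => ?_
    rw [Finset.sum_div]
    refine Finset.sum_congr rfl fun i _ => ?_
    rw [eq_div_iff two_ne_zero, mul_comm, ← mul_assoc, Real.two_mul_cos_mul_cos]
    push_cast
    congr 2 <;> ring
  rw [Finset.sum_congr rfl e, ← Finset.sum_div, Finset.sum_comm]
  have e2 : ∀ j ∈ Finset.Icc 1 r, ∑ k ∈ Finset.range n, ∑ i ∈ Finset.Icc 1 r,
      (Real.cos (2 * Real.pi * ((j - i : ℤ) : ℝ) / n * k) +
        Real.cos (2 * Real.pi * ((j + i : ℤ) : ℝ) / n * k)) = n := by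
    intro j hj
    rw [Finset.mem_Icc] at hj
    rw [Finset.sum_comm, Finset.sum_eq_single_of_mem j (Finset.mem_Icc.2 hj)]
    · rw [Finset.sum_add_distrib, sum_cos_int_mul hn, sum_cos_int_mul hn, if_pos (by simp), if_neg,
        add_zero]
      intro hd
      have := Int.le_of_dvd (by lia) hd
      lia
    · intro i hi hij
      rw [Finset.mem_Icc] at hi
      rw [Finset.sum_add_distrib, sum_cos_int_mul hn, sum_cos_int_mul hn, if_neg, if_neg, add_zero]
      · intro hd
        have := Int.le_of_dvd (by lia) hd
        lia
      · intro hd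
        have := Int.eq_zero_of_abs_lt_dvd hd (by rw [abs_lt]; lia)
        lia
  rw [Finset.sum_congr rfl e2]
  simp only [Finset.sum_const, Nat.card_Icc, Nat.add_sub_cancel, nsmul_eq_mul]
  field_simp

theorem sum_Icc_sq_ge (r : ℕ) : (r : ℝ) ^ 3 / 3 ≤ ∑ j ∈ Finset.Icc 1 r, (j : ℝ) ^ 2 := by
  induction r with
  | zero => simp
  | succ m ih =>
    rw [Finset.sum_Icc_succ_top (by lia)]
    push_cast
    nlinarith [(Nat.cast_nonneg m : (0 : ℝ) ≤ m)]

/-- Telescoping form of the Dirichlet kernel. -/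
theorem sin_mul_sum_cos_Icc (x : ℝ) (r : ℕ) :
    2 * Real.sin x * ∑ j ∈ Finset.Icc 1 r, Real.cos (2 * j * x) =
      Real.sin ((2 * r + 1) * x) - Real.sin x := by
  induction r with
  | zero => simp
  | succ m ih =>
    rw [Finset.sum_Icc_succ_top (by lia), mul_add, ih]
    have e1 : (2 * ((m + 1 : ℕ) : ℝ) + 1) * x = 2 * ((m + 1 : ℕ) : ℝ) * x + x := by ring
    have e2 : (2 * (m : ℝ) + 1) * x = 2 * ((m + 1 : ℕ) : ℝ) * x - x := by push_cast; ring
    rw [e1, e2, Real.sin_add, Real.sin_sub]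
    ring

/-- Away from the frequency `0` the eigenvalue is bounded away from `1`, or quadratically so. -/
theorem eigenvalue_le_half_or {k : ℕ} (hr : r ≠ 0) (hk : k ≠ 0) (hkn : 2 * k ≤ n) :
    eigenvalue n r k ≤ 1 / 2 ∨ ((k : ℝ) * r / n) ^ 2 ≤ 1 - eigenvalue n r k := by
  have hr0 : (0 : ℝ) < r := by exact_mod_cast Nat.pos_of_ne_zero hr
  have hk0 : (0 : ℝ) < k := by exact_mod_cast Nat.pos_of_ne_zero hk
  have hn0 : (0 : ℝ) < n := by exact_mod_cast (show 0 < n by lia)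
  have hkn' : 2 * (k : ℝ) ≤ n := by exact_mod_cast hkn
  have hpi := Real.pi_pos
  set x := Real.pi * k / n with hx
  have hcos : ∀ j : ℕ, Real.cos (2 * Real.pi * j / n * k) = Real.cos (2 * j * x) := fun j => by
    congr 1; rw [hx]; ring
  have hsin : ∀ j : ℕ, 2 * (j : ℝ) * k ≤ n → 2 * (j : ℝ) * k / n ≤ Real.sin (j * x) := by
    intro j hj
    have h := Real.mul_le_sin (x := j * x) (by positivity) (by
      rw [hx, ← mul_div_assoc, div_le_div_iff₀ hn0 two_pos]; nlinarith)
    refine le_trans (le_of_eq ?_) h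
    rw [hx]; field_simp
  -- If `2 k r ≤ n`, all angles `j * x` lie in `[0, π/2]`, and Jordan's inequality gives `1 - λ ≥
  -- (8/3) (k r / n)²`. Otherwise the Dirichlet kernel gives a cosine sum of at most `1 / (2 sin x)
  -- ≤ n / (4 k) < r / 2`.
  by_cases hc : 2 * (k : ℝ) * r ≤ n
  · right
    have e : 1 - eigenvalue n r k = (∑ j ∈ Finset.Icc 1 r, 2 * Real.sin (j * x) ^ 2) / r := by
      rw [eigenvalue, eq_div_iff hr0.ne', sub_mul, div_mul_cancel₀ _ hr0.ne', one_mul]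
      have : (r : ℝ) = ∑ _j ∈ Finset.Icc 1 r, (1 : ℝ) := by simp
      nth_rewrite 1 [this]
      rw [← Finset.sum_sub_distrib]
      refine Finset.sum_congr rfl fun j _ => ?_
      rw [hcos, mul_assoc 2 (j : ℝ) x, Real.cos_two_mul, Real.cos_sq']
      ring
    rw [e, le_div_iff₀ hr0]
    calc ((k : ℝ) * r / n) ^ 2 * r ≤ 8 * (k / n) ^ 2 * ((r : ℝ) ^ 3 / 3) := by
          rw [div_pow, div_pow, mul_pow]
          have : 0 ≤ (k : ℝ) ^ 2 / n ^ 2 * r ^ 3 := by positivity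
          calc (k : ℝ) ^ 2 * r ^ 2 / n ^ 2 * r = (k : ℝ) ^ 2 / n ^ 2 * r ^ 3 := by ring
            _ ≤ _ := by linarith
      _ ≤ 8 * (k / n) ^ 2 * ∑ j ∈ Finset.Icc 1 r, (j : ℝ) ^ 2 := by
          gcongr; exact sum_Icc_sq_ge r
      _ ≤ _ := by
          rw [Finset.mul_sum]
          refine Finset.sum_le_sum fun j hj => ?_
          rw [Finset.mem_Icc] at hj
          have hjr : (j : ℝ) ≤ r := by exact_mod_cast hj.2
          have := hsin j (by nlinarith)
          have h2 := pow_le_pow_left₀ (by positivity) this 2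
          calc 8 * ((k : ℝ) / n) ^ 2 * (j : ℝ) ^ 2 = 2 * (2 * (j : ℝ) * k / n) ^ 2 := by ring
            _ ≤ _ := by linarith
  · left
    push Not at hc
    have h1 := hsin 1 (by push_cast; linarith)
    simp only [Nat.cast_one, mul_one, one_mul] at h1
    have hs0 : 0 < Real.sin x := lt_of_lt_of_le (by positivity) h1
    have hD := sin_mul_sum_cos_Icc x r
    simp only [eigenvalue, hcos]
    set S := ∑ j ∈ Finset.Icc 1 r, Real.cos (2 * j * x)
    have hS : 2 * Real.sin x * S ≤ 1 := by linarith [Real.sin_le_one ((2 * r + 1) * x)]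
    rw [div_le_iff₀ hr0]
    by_cases hS0 : S ≤ 0
    · linarith
    push Not at hS0
    have h2 : 2 * (2 * k / n) * S ≤ 1 := le_trans (by gcongr) hS
    have h3 : 4 * k * S ≤ n := by
      have : 2 * (2 * k / n) * S = 4 * k * S / n := by ring
      rw [this, div_le_one hn0] at h2
      exact h2
    have h4 : k * (4 * S) < k * (2 * r) := by nlinarith
    have := lt_of_mul_lt_mul_left h4 hk0.le
    linarith

end Eigenvalue

/-! ### Spectral sums -/

section Sums

variable {n r : ℕ}

/-- The third bound merges the two alternatives of `eigenvalue_le_half_or`: the first term is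
summable through the Frobenius norm, the second through `∑ 1/k²`. -/
theorem eigenvalue_gap_of_two_mul_le {k : ℕ} (hr : r ≠ 0) (h : 2 * r < n) (hk : k ≠ 0)
    (hkn : 2 * k ≤ n) :
    eigenvalue n r k < 1 ∧ (1 - eigenvalue n r k)⁻¹ ≤ ((n : ℝ) / r) ^ 2 ∧
      eigenvalue n r k ^ 2 / (1 - eigenvalue n r k) ≤
        2 * eigenvalue n r k ^ 2 + ((n : ℝ) / r) ^ 2 * ((k : ℝ) ^ 2)⁻¹ := by
  have hr0 : (0 : ℝ) < r := by exact_mod_cast Nat.pos_of_ne_zero hr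
  have hk1 : (1 : ℝ) ≤ k := by exact_mod_cast Nat.pos_of_ne_zero hk
  have hn0 : (0 : ℝ) < n := by exact_mod_cast (show 0 < n by lia)
  have hnr : 2 ≤ (n : ℝ) / r := by
    rw [le_div_iff₀ hr0]; exact_mod_cast h.le
  set E := eigenvalue n r k
  rcases eigenvalue_le_half_or hr hk hkn with hE | hE
  · have h1 : 0 < 1 - E := by linarith
    have h2 : (1 - E)⁻¹ ≤ 2 := by
      rw [inv_le_comm₀ h1 two_pos]; linarith
    refine ⟨by linarith, h2.trans (by nlinarith), ?_⟩
    rw [div_eq_mul_inv]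
    have : 0 ≤ ((n : ℝ) / r) ^ 2 * ((k : ℝ) ^ 2)⁻¹ := by positivity
    nlinarith [sq_nonneg E]
  · have hp : 0 < ((k : ℝ) * r / n) ^ 2 := by positivity
    have h1 : 0 < 1 - E := hp.trans_le hE
    have h2 : (1 - E)⁻¹ ≤ ((n : ℝ) / r) ^ 2 * ((k : ℝ) ^ 2)⁻¹ := by
      refine (inv_anti₀ hp hE).trans (le_of_eq ?_)
      field_simp
    refine ⟨by linarith, h2.trans ?_, ?_⟩
    · exact mul_le_of_le_one_right (by positivity) (inv_le_one_of_one_le₀ (one_le_pow₀ hk1))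
    · have hE2 : E ^ 2 ≤ 1 := by
        rw [← sq_abs]; exact pow_le_one₀ (abs_nonneg _) (abs_eigenvalue_le k)
      have h3 : E ^ 2 / (1 - E) ≤ (1 - E)⁻¹ := by
        rw [div_eq_mul_inv]; exact mul_le_of_le_one_left (inv_pos.2 h1).le hE2
      nlinarith [sq_nonneg E]

/-- The symmetry `k ↦ n - k` reduces to frequencies at most `n / 2`; adding both inverse squares
avoids separating the two halves when summing. -/
theorem eigenvalue_gap {k : ℕ} (hr : r ≠ 0) (h : 2 * r < n) (hk : k ≠ 0) (hkn : k < n) :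
    eigenvalue n r k < 1 ∧ (1 - eigenvalue n r k)⁻¹ ≤ ((n : ℝ) / r) ^ 2 ∧
      eigenvalue n r k ^ 2 / (1 - eigenvalue n r k) ≤ 2 * eigenvalue n r k ^ 2 +
        ((n : ℝ) / r) ^ 2 * (((k : ℝ) ^ 2)⁻¹ + (((n - k : ℕ) : ℝ) ^ 2)⁻¹) := by
  have hp1 : 0 ≤ ((n : ℝ) / r) ^ 2 * ((k : ℝ) ^ 2)⁻¹ := by positivity
  have hp2 : 0 ≤ ((n : ℝ) / r) ^ 2 * (((n - k : ℕ) : ℝ) ^ 2)⁻¹ := by positivity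
  rw [mul_add]
  rcases le_total (2 * k) n with hc | hc
  · obtain ⟨h1, h2, h3⟩ := eigenvalue_gap_of_two_mul_le hr h hk hc
    exact ⟨h1, h2, by linarith⟩
  · obtain ⟨h1, h2, h3⟩ := eigenvalue_gap_of_two_mul_le (k := n - k) hr h (by lia) (by lia)
    rw [eigenvalue_sub hkn.le (by lia)] at h1 h2 h3
    exact ⟨h1, h2, by linarith⟩

theorem sum_inv_sq_succ_le (d : ℕ) : ∑ k : Fin d, ((((k : ℕ) + 1 : ℕ) : ℝ) ^ 2)⁻¹ ≤ 2 := by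
  rw [Fin.sum_univ_eq_sum_range (fun k => (((k + 1 : ℕ) : ℝ) ^ 2)⁻¹) d]
  have h := sum_Ioo_inv_sq_le (α := ℝ) 0 (d + 1)
  have e : ∑ i ∈ Finset.range d, (((i + 1 : ℕ) : ℝ) ^ 2)⁻¹ =
      ∑ i ∈ Finset.Ioo 0 (d + 1), ((i : ℝ) ^ 2)⁻¹ := by
    rw [Finset.sum_bij (fun i _ => i + 1)]
    · intro i hi; simp at hi ⊢; lia
    · intro a _ b _ hab; lia
    · intro b hb
      simp at hb
      exact ⟨b - 1, by simp; lia, by lia⟩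
    · intro i _; rfl
  rw [e]
  simpa using h

variable {d : ℕ}

theorem sum_eigenvalue_succ (hr : r ≠ 0) (h : 2 * r < d + 1) :
    ∑ k : Fin d, eigenvalue (d + 1) r ((k : ℕ) + 1) = -1 := by
  have h1 := sum_eigenvalue (n := d + 1) (r := r) (by lia)
  rw [Finset.sum_range_succ', eigenvalue_zero hr] at h1
  rw [Fin.sum_univ_eq_sum_range (fun k => eigenvalue (d + 1) r (k + 1)) d]
  linarith

theorem sum_sq_div_gap_le (hr : r ≠ 0) (h : 2 * r < d + 1) :
    ∑ k : Fin d, eigenvalue (d + 1) r ((k : ℕ) + 1) ^ 2 / (1 - eigenvalue (d + 1) r ((k : ℕ) + 1)) ≤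
      5 * (((d + 1 : ℕ) : ℝ) / r) ^ 2 := by
  have hr0 : (0 : ℝ) < r := by exact_mod_cast Nat.pos_of_ne_zero hr
  have hnr : 2 ≤ ((d + 1 : ℕ) : ℝ) / r := by
    rw [le_div_iff₀ hr0]; exact_mod_cast h.le
  have hsq : ∑ k : Fin d, eigenvalue (d + 1) r ((k : ℕ) + 1) ^ 2 ≤ ((d + 1 : ℕ) : ℝ) / (2 * r) := by
    rw [← sum_eigenvalue_sq hr h, Finset.sum_range_succ',
      Fin.sum_univ_eq_sum_range (fun k => eigenvalue (d + 1) r (k + 1) ^ 2) d]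
    exact le_add_of_nonneg_right (sq_nonneg _)
  have hrev : ∑ k : Fin d, (((d + 1 - ((k : ℕ) + 1) : ℕ) : ℝ) ^ 2)⁻¹ ≤ 2 := by
    rw [← Equiv.sum_comp Fin.revPerm]
    refine le_trans (le_of_eq (Finset.sum_congr rfl fun k _ => ?_)) (sum_inv_sq_succ_le d)
    congr 3
    simp only [Fin.revPerm_apply, Fin.val_rev]
    have := k.2
    lia
  calc _ ≤ ∑ k : Fin d, (2 * eigenvalue (d + 1) r ((k : ℕ) + 1) ^ 2 +
        (((d + 1 : ℕ) : ℝ) / r) ^ 2 * (((((k : ℕ) + 1 : ℕ) : ℝ) ^ 2)⁻¹ +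
          (((d + 1 - ((k : ℕ) + 1) : ℕ) : ℝ) ^ 2)⁻¹)) :=
        Finset.sum_le_sum fun k _ => (eigenvalue_gap hr h (by lia) (by have := k.2; lia)).2.2
    _ = 2 * ∑ k : Fin d, eigenvalue (d + 1) r ((k : ℕ) + 1) ^ 2 +
        (((d + 1 : ℕ) : ℝ) / r) ^ 2 * (∑ k : Fin d, ((((k : ℕ) + 1 : ℕ) : ℝ) ^ 2)⁻¹ +
          ∑ k : Fin d, (((d + 1 - ((k : ℕ) + 1) : ℕ) : ℝ) ^ 2)⁻¹) := by
        rw [Finset.sum_add_distrib, ← Finset.mul_sum, ← Finset.mul_sum, Finset.sum_add_distrib]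
    _ ≤ 2 * (((d + 1 : ℕ) : ℝ) / (2 * r)) + (((d + 1 : ℕ) : ℝ) / r) ^ 2 * (2 + 2) := by
        gcongr; exact sum_inv_sq_succ_le d
    _ = ((d + 1 : ℕ) : ℝ) / r + 4 * (((d + 1 : ℕ) : ℝ) / r) ^ 2 := by field_simp; ring
    _ ≤ _ := by nlinarith

/-- Since `λ/(1 - λ) = λ + λ²/(1 - λ)` and the linear terms sum to `-1`, only the quadratic sum
remains. -/
theorem abs_sum_div_gap_le (hr : r ≠ 0) (h : 2 * r < d + 1) :
    |∑ k : Fin d, eigenvalue (d + 1) r ((k : ℕ) + 1) / (1 - eigenvalue (d + 1) r ((k : ℕ) + 1))| ≤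
      6 * (((d + 1 : ℕ) : ℝ) / r) ^ 2 := by
  have hr0 : (0 : ℝ) < r := by exact_mod_cast Nat.pos_of_ne_zero hr
  have hnr : 2 ≤ ((d + 1 : ℕ) : ℝ) / r := by
    rw [le_div_iff₀ hr0]; exact_mod_cast h.le
  have hlt : ∀ k : Fin d, 0 < 1 - eigenvalue (d + 1) r ((k : ℕ) + 1) := fun k =>
    sub_pos.2 (eigenvalue_gap hr h (by lia) (by have := k.2; lia)).1
  have e : ∑ k : Fin d, eigenvalue (d + 1) r ((k : ℕ) + 1) / (1 - eigenvalue (d + 1) r ((k : ℕ) + 1)) =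
      -1 + ∑ k : Fin d, eigenvalue (d + 1) r ((k : ℕ) + 1) ^ 2 /
        (1 - eigenvalue (d + 1) r ((k : ℕ) + 1)) := by
    rw [← sum_eigenvalue_succ hr h, ← Finset.sum_add_distrib]
    refine Finset.sum_congr rfl fun k _ => ?_
    have := (hlt k).ne'
    field_simp
    ring
  have h0 : 0 ≤ ∑ k : Fin d, eigenvalue (d + 1) r ((k : ℕ) + 1) ^ 2 /
      (1 - eigenvalue (d + 1) r ((k : ℕ) + 1)) :=
    Finset.sum_nonneg fun k _ => div_nonneg (sq_nonneg _) (hlt k).le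
  have h1 := sum_sq_div_gap_le hr h
  rw [e, abs_le]
  constructor <;> nlinarith

/-- One factor `1 / (1 - λ)` is bounded by `(n/r)²`, leaving the sum of `λ²/(1 - λ)`. -/
theorem sum_div_gap_sq_le (hr : r ≠ 0) (h : 2 * r < d + 1) :
    ∑ k : Fin d, (eigenvalue (d + 1) r ((k : ℕ) + 1) / (1 - eigenvalue (d + 1) r ((k : ℕ) + 1))) ^ 2 ≤
      5 * (((d + 1 : ℕ) : ℝ) / r) ^ 4 := by
  calc _ ≤ ∑ k : Fin d, (((d + 1 : ℕ) : ℝ) / r) ^ 2 * (eigenvalue (d + 1) r ((k : ℕ) + 1) ^ 2 /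
        (1 - eigenvalue (d + 1) r ((k : ℕ) + 1))) := by
        refine Finset.sum_le_sum fun k _ => ?_
        obtain ⟨h1, h2, -⟩ := eigenvalue_gap (k := (k : ℕ) + 1) hr h (by lia) (by have := k.2; lia)
        have hp : 0 ≤ eigenvalue (d + 1) r ((k : ℕ) + 1) ^ 2 /
          (1 - eigenvalue (d + 1) r ((k : ℕ) + 1)) := div_nonneg (sq_nonneg _) (by linarith)
        calc _ = (1 - eigenvalue (d + 1) r ((k : ℕ) + 1))⁻¹ * (eigenvalue (d + 1) r ((k : ℕ) + 1) ^ 2 /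
              (1 - eigenvalue (d + 1) r ((k : ℕ) + 1))) := by ring
          _ ≤ _ := by gcongr
    _ ≤ (((d + 1 : ℕ) : ℝ) / r) ^ 2 * (5 * (((d + 1 : ℕ) : ℝ) / r) ^ 2) := by
        rw [← Finset.mul_sum]
        gcongr
        exact sum_sq_div_gap_le hr h
    _ = _ := by ring

end Sums

/-- The growth hypothesis enters here: `(n/r)² / √n = (n^(3/4) / r)²` tends to 0, and both spectral
sums are controlled by this quantity or its square. -/
theorem spectralConditions_eigenvalue {r : ℕ → ℕ}
    (hr : ∀ᶠ n : ℕ in atTop, 0 < 2 * r n ∧ 2 * r n < n)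
    (hlim : Tendsto (fun n : ℕ => (r n : ℝ) / (n : ℝ) ^ (3 / 4 : ℝ)) atTop atTop) :
    SpectralConditions fun d k => eigenvalue (d + 1) (r (d + 1)) ((k : ℕ) + 1) := by
  have hr' : ∀ᶠ d : ℕ in atTop, r (d + 1) ≠ 0 ∧ 2 * r (d + 1) < d + 1 := by
    filter_upwards [(tendsto_add_atTop_nat 1).eventually hr] with d hd
    lia
  have hX : Tendsto (fun d : ℕ => (((d + 1 : ℕ) : ℝ) ^ (3 / 4 : ℝ) / r (d + 1)) ^ 2) atTop (𝓝 0) := by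
    have := ((hlim.comp (tendsto_add_atTop_nat 1)).inv_tendsto_atTop).pow 2
    simpa using this
  have e1 : ∀ d : ℕ, (((d + 1 : ℕ) : ℝ) / r (d + 1)) ^ 2 / √((d : ℝ) + 1) =
      (((d + 1 : ℕ) : ℝ) ^ (3 / 4 : ℝ) / r (d + 1)) ^ 2 := by
    intro d
    have hp : (0 : ℝ) < (d : ℝ) + 1 := by positivity
    push_cast
    rw [div_pow, div_pow, div_right_comm]
    congr 1
    rw [Real.sqrt_eq_rpow, ← Real.rpow_natCast, ← Real.rpow_natCast, ← Real.rpow_sub hp,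
      ← Real.rpow_mul hp.le]
    norm_num
  have e2 : ∀ d : ℕ, (((d + 1 : ℕ) : ℝ) / r (d + 1)) ^ 4 / ((d : ℝ) + 1) =
      ((((d + 1 : ℕ) : ℝ) ^ (3 / 4 : ℝ) / r (d + 1)) ^ 2) ^ 2 := by
    intro d
    have : (d : ℝ) + 1 = √((d : ℝ) + 1) ^ 2 := (Real.sq_sqrt (by positivity)).symm
    rw [← e1, div_pow _ (√((d : ℝ) + 1)), ← this]
    ring
  refine ⟨?_, ?_, ?_, ?_⟩
  · filter_upwards [hr'] with d hd k
    exact (eigenvalue_gap hd.1 hd.2 (by lia) (by have := k.2; lia)).1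
  · filter_upwards [hr'] with d hd
    exact sum_eigenvalue_succ hd.1 hd.2
  · have h0 := hX.const_mul 6
    rw [mul_zero] at h0
    refine squeeze_zero_norm' ?_ h0
    filter_upwards [hr'] with d hd
    rw [← e1, norm_div, Real.norm_eq_abs, Real.norm_eq_abs, abs_of_nonneg (Real.sqrt_nonneg _),
      ← mul_div_assoc]
    gcongr
    exact abs_sum_div_gap_le hd.1 hd.2
  · have h0 := (hX.pow 2).const_mul 5
    rw [zero_pow two_ne_zero, mul_zero] at h0
    refine squeeze_zero' (Eventually.of_forall fun d => ?_) ?_ h0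
    · exact div_nonneg (Finset.sum_nonneg fun _ _ => sq_nonneg _) (by positivity)
    · filter_upwards [hr'] with d hd
      rw [← e2, ← mul_div_assoc]
      gcongr
      exact sum_div_gap_sq_le hd.1 hd.2

/-! ### Diagonalization by the Hartley transform -/

/-- The orthogonal matrix of the discrete Hartley transform. -/
noncomputable def hartley (n : ℕ) : Matrix (Fin n) (Fin n) ℝ := fun i k =>
  (Real.cos (2 * Real.pi * k / n * i) + Real.sin (2 * Real.pi * k / n * i)) / √n

section Hartley

variable {n : ℕ}

theorem hartley_symm (i k : Fin n) : hartley n i k = hartley n k i := by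
  unfold hartley
  rw [show 2 * Real.pi * (k : ℝ) / n * i = 2 * Real.pi * i / n * k by ring]

theorem hartley_shift (i k : Fin n) (j : ℕ) :
    hartley n (shift i j) k =
      (Real.cos (2 * Real.pi * k / n * j) *
          (Real.cos (2 * Real.pi * k / n * i) + Real.sin (2 * Real.pi * k / n * i)) +
        Real.sin (2 * Real.pi * k / n * j) *
          (Real.cos (2 * Real.pi * k / n * i) - Real.sin (2 * Real.pi * k / n * i))) / √n := by
  have hn' : (n : ℝ) ≠ 0 := by exact_mod_cast i.pos.ne'
  unfold hartley shift
  congr 1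
  have hmod : ((((i : ℕ) + j) % n : ℕ) : ℝ) = i + j - n * (((i : ℕ) + j) / n : ℕ) := by
    have := Nat.mod_add_div ((i : ℕ) + j) n
    have h2 : ((((i : ℕ) + j) % n : ℕ) : ℝ) + n * (((i : ℕ) + j) / n : ℕ) = i + j := by
      exact_mod_cast this
    linarith
  simp only
  rw [hmod]
  set q := ((i : ℕ) + j) / n
  have e : 2 * Real.pi * (k : ℝ) / n * (i + j - n * q) =
      (2 * Real.pi * k / n * i + 2 * Real.pi * k / n * j) - ((k * q : ℕ) : ℝ) * (2 * Real.pi) := by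
    push_cast; field_simp
  rw [e, Real.cos_sub_nat_mul_two_pi, Real.sin_sub_nat_mul_two_pi, Real.cos_add, Real.sin_add]
  ring

/-- The product of the two summands is `cos (a - b) + sin (a + b)`, and the sines sum to zero over a
full period whatever the frequency. -/
theorem sum_cas_mul_cas (hn : n ≠ 0) (k m : ℤ) :
    ∑ i ∈ Finset.range n, (Real.cos (2 * Real.pi * k / n * i) + Real.sin (2 * Real.pi * k / n * i)) *
      (Real.cos (2 * Real.pi * m / n * i) + Real.sin (2 * Real.pi * m / n * i)) =
      if (n : ℤ) ∣ k - m then (n : ℝ) else 0 := by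
  rw [← sum_cos_int_mul hn, ← add_zero (∑ i ∈ Finset.range n,
    Real.cos (2 * Real.pi * ((k - m : ℤ) : ℝ) / n * i)), ← sum_sin_int_mul n (k + m),
    ← Finset.sum_add_distrib]
  refine Finset.sum_congr rfl fun i _ => ?_
  have e1 : 2 * Real.pi * ((k - m : ℤ) : ℝ) / n * i =
      2 * Real.pi * k / n * i - 2 * Real.pi * m / n * i := by push_cast; ring
  have e2 : 2 * Real.pi * ((k + m : ℤ) : ℝ) / n * i =
      2 * Real.pi * k / n * i + 2 * Real.pi * m / n * i := by push_cast; ring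
  rw [e1, e2, Real.cos_sub, Real.sin_add]
  ring

/-- A shift turns the column of frequency `l` into a combination of the columns of frequencies `l`
and `-l`, with coefficients the cosine and the sine. -/
theorem sum_hartley_mul_hartley_shift (k l : Fin n) (j : ℕ) :
    ∑ i, hartley n i k * hartley n (shift i j) l =
      Real.cos (2 * Real.pi * l / n * j) * (if k = l then 1 else 0) +
      Real.sin (2 * Real.pi * l / n * j) *
        (if (n : ℤ) ∣ (k : ℤ) + (l : ℤ) then 1 else 0) := by
  have hn : n ≠ 0 := k.pos.ne'
  have hn' : (n : ℝ) ≠ 0 := by exact_mod_cast hn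
  have hsq : √(n : ℝ) * √(n : ℝ) = n := Real.mul_self_sqrt (Nat.cast_nonneg n)
  obtain ⟨F, hF⟩ : ∃ F : ℕ → ℝ, F = fun i : ℕ =>
      (Real.cos (2 * Real.pi * l / n * j) / n) *
      ((Real.cos (2 * Real.pi * ((k : ℤ) : ℝ) / n * i) + Real.sin (2 * Real.pi * ((k : ℤ) : ℝ) / n * i)) *
      (Real.cos (2 * Real.pi * ((l : ℤ) : ℝ) / n * i) + Real.sin (2 * Real.pi * ((l : ℤ) : ℝ) / n * i))) +
      (Real.sin (2 * Real.pi * l / n * j) / n) *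
      ((Real.cos (2 * Real.pi * ((k : ℤ) : ℝ) / n * i) + Real.sin (2 * Real.pi * ((k : ℤ) : ℝ) / n * i)) *
      (Real.cos (2 * Real.pi * ((-l : ℤ) : ℝ) / n * i) +
        Real.sin (2 * Real.pi * ((-l : ℤ) : ℝ) / n * i))) := ⟨_, rfl⟩
  have e : ∀ i : Fin n, hartley n i k * hartley n (shift i j) l = F i := by
    intro i
    rw [hartley_shift, hartley, hF]
    have e1 : 2 * Real.pi * ((-l : ℤ) : ℝ) / n * ((i : ℕ) : ℝ) = -(2 * Real.pi * l / n * i) := by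
      push_cast; ring
    simp only [e1, Real.cos_neg, Real.sin_neg, Int.cast_natCast]
    rw [div_mul_div_comm, hsq]
    ring
  rw [Finset.sum_congr rfl fun i _ => e i, Fin.sum_univ_eq_sum_range F, hF, Finset.sum_add_distrib,
    ← Finset.mul_sum, ← Finset.mul_sum, sum_cas_mul_cas hn, sum_cas_mul_cas hn, sub_neg_eq_add]
  have e2 : ((n : ℤ) ∣ (k : ℤ) - (l : ℤ)) ↔ k = l := by
    constructor
    · intro h
      have hk := k.2
      have hl := l.2
      have := Int.eq_zero_of_abs_lt_dvd h (by rw [abs_lt]; constructor <;> omega)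
      exact Fin.ext (by lia)
    · rintro rfl; simp
  simp only [e2]
  congr 1 <;> split_ifs <;> simp <;> field_simp

theorem shift_zero (i : Fin n) : shift i 0 = i := by
  ext; simp [shift, Nat.mod_eq_of_lt i.2]

theorem sum_hartley_mul_hartley (k l : Fin n) :
    ∑ i, hartley n i k * hartley n i l = if k = l then 1 else 0 := by
  simpa [shift_zero] using sum_hartley_mul_hartley_shift k l 0

theorem hartley_mul_self : hartley n * hartley n = 1 := by
  ext k l
  rw [Matrix.mul_apply, Matrix.one_apply, ← sum_hartley_mul_hartley]
  exact Finset.sum_congr rfl fun i _ => by rw [hartley_symm k i]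

theorem abs_det_hartley : |(hartley n).det| = 1 := by
  have h := congrArg Matrix.det (hartley_mul_self (n := n))
  rw [Matrix.det_mul, Matrix.det_one] at h
  have h2 : |(hartley n).det| * |(hartley n).det| = 1 := by rw [← abs_mul, h, abs_one]
  nlinarith [abs_nonneg (hartley n).det]

theorem measurePreserving_hartley :
    MeasurePreserving (Matrix.mulVec (hartley n)) (volume : Measure (Fin n → ℝ)) volume := by
  have hd : (hartley n).det ≠ 0 := fun h => by
    have := abs_det_hartley (n := n)
    simp [h] at this
  have h := Real.map_matrix_volume_pi_eq_smul_volume_pi hd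
  rw [abs_inv, abs_det_hartley, inv_one, ENNReal.ofReal_one, one_smul] at h
  refine ⟨?_, h⟩
  exact (LinearMap.continuous_of_finiteDimensional (Matrix.toLin' (hartley n))).measurable

theorem correlation_hartley (y : Fin n → ℝ) (j : ℕ) :
    ∑ i, (hartley n).mulVec y i * (hartley n).mulVec y (shift i j) =
      ∑ k : Fin n, Real.cos (2 * Real.pi * k / n * j) * y k ^ 2 := by
  have e1 : ∀ i, (hartley n).mulVec y i * (hartley n).mulVec y (shift i j) =
      ∑ k, ∑ l, y k * y l * (hartley n i k * hartley n (shift i j) l) := by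
    intro i
    rw [Matrix.mulVec, Matrix.mulVec, dotProduct, dotProduct, Finset.sum_mul_sum]
    exact Finset.sum_congr rfl fun k _ => Finset.sum_congr rfl fun l _ => by ring
  have e2 : ∑ i, (hartley n).mulVec y i * (hartley n).mulVec y (shift i j) =
      ∑ k, ∑ l, y k * y l * (Real.cos (2 * Real.pi * l / n * j) * (if k = l then 1 else 0) +
      Real.sin (2 * Real.pi * l / n * j) *
        (if (n : ℤ) ∣ (k : ℤ) + (l : ℤ) then 1 else 0)) := by
    rw [Finset.sum_congr rfl fun i _ => e1 i, Finset.sum_comm]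
    refine Finset.sum_congr rfl fun k _ => ?_
    rw [Finset.sum_comm]
    refine Finset.sum_congr rfl fun l _ => ?_
    rw [← Finset.mul_sum, sum_hartley_mul_hartley_shift]
  -- Only pairs with `k ≡ -l` modulo `n` contribute. Exchanging `k` and `l` reverses the sign of the
  -- sine, so the sum equals its own negative.
  have e3 : ∑ k : Fin n, ∑ l : Fin n, y k * y l * (Real.sin (2 * Real.pi * l / n * j) *
        (if (n : ℤ) ∣ (k : ℤ) + (l : ℤ) then 1 else 0)) = 0 := by
    set X := ∑ k : Fin n, ∑ l : Fin n, y k * y l * (Real.sin (2 * Real.pi * l / n * j) *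
        (if (n : ℤ) ∣ (k : ℤ) + (l : ℤ) then 1 else 0)) with hX
    have : X = -X := by
      conv_lhs => rw [hX, Finset.sum_comm]
      rw [hX, ← Finset.sum_neg_distrib]
      refine Finset.sum_congr rfl fun k _ => ?_
      rw [← Finset.sum_neg_distrib]
      refine Finset.sum_congr rfl fun l _ => ?_
      by_cases h : (n : ℤ) ∣ (k : ℤ) + (l : ℤ)
      · have hn' : (n : ℝ) ≠ 0 := by exact_mod_cast k.pos.ne'
        rw [if_pos h, if_pos (by rwa [add_comm])]
        obtain ⟨c, hc⟩ := h
        have hk : (k : ℝ) = n * c - l := by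
          have : (k : ℝ) + l = n * c := by exact_mod_cast hc
          linarith
        have : 2 * Real.pi * (k : ℝ) / n * j = ((c * j : ℤ) : ℝ) * (2 * Real.pi) -
            2 * Real.pi * l / n * j := by
          rw [hk]; push_cast; field_simp
        rw [this, Real.sin_int_mul_two_pi_sub]
        ring
      · rw [if_neg h, if_neg (by rwa [add_comm])]
        ring
    linarith
  rw [e2]
  simp only [mul_add, Finset.sum_add_distrib]
  rw [e3, add_zero]
  refine Finset.sum_congr rfl fun k _ => ?_
  rw [Finset.sum_eq_single k]
  · rw [if_pos rfl]; ring
  · intro l _ hl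
    rw [if_neg (Ne.symm hl)]; ring
  · simp

theorem normSq_hartley (y : Fin n → ℝ) : normSq ((hartley n).mulVec y) = normSq y := by
  have h := correlation_hartley y 0
  simp only [shift_zero, Nat.cast_zero, mul_zero, Real.cos_zero, one_mul] at h
  rw [normSq, normSq, ← h]
  exact Finset.sum_congr rfl fun i _ => sq _

theorem hamiltonian_hartley (r : ℕ) (y : Fin n → ℝ) :
    hamiltonian n r ((hartley n).mulVec y) = -(diagForm (fun k : Fin n => eigenvalue n r k) y / 2) := by
  rw [hamiltonian, Finset.sum_comm, Finset.sum_congr rfl fun j _ => correlation_hartley y j,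
    Finset.sum_comm, diagForm, neg_mul, Finset.mul_sum, Finset.sum_div]
  congr 1
  refine Finset.sum_congr rfl fun k _ => ?_
  rw [← Finset.sum_mul, eigenvalue]
  have : ∀ j : ℕ, 2 * Real.pi * (k : ℝ) / n * j = 2 * Real.pi * j / n * k := fun j => by ring
  simp only [this]
  ring

/-- Column 0 is constant and the other columns are orthogonal to it, so summing the sites extracts
`y 0`. -/
theorem magnetization_hartley {d : ℕ} (y : Fin (d + 1) → ℝ) :
    magnetization (d + 1) ((hartley (d + 1)).mulVec y) = √((d : ℝ) + 1) * y 0 := by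
  have hp : 0 < √((d : ℝ) + 1) := Real.sqrt_pos.2 (by positivity)
  have hs : √((d : ℝ) + 1) ^ 2 = d + 1 := Real.sq_sqrt (by positivity)
  have h1 : ∀ i : Fin (d + 1), hartley (d + 1) i 0 = (√((d : ℝ) + 1))⁻¹ := fun i => by
    simp [hartley]
  have e : ∀ k : Fin (d + 1), ∑ i, hartley (d + 1) i k =
      √((d : ℝ) + 1) * if (0 : Fin (d + 1)) = k then 1 else 0 := fun k => by
    rw [← sum_hartley_mul_hartley, Finset.mul_sum]
    refine Finset.sum_congr rfl fun i _ => ?_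
    rw [h1]; field_simp
  simp only [magnetization, Matrix.mulVec, dotProduct]
  rw [Finset.sum_comm, Finset.sum_eq_single 0]
  · rw [← Finset.sum_mul, e, if_pos rfl, mul_one]
  · intro k _ hk
    rw [← Finset.sum_mul, e, if_neg hk.symm, mul_zero, zero_mul]
  · simp

end Hartley

/-! ### Convergence in distribution on varying spaces -/

theorem tendstoInDistribution_iff_lintegral {ι Ω' : Type*} {Ω : ι → Type*}
    [∀ i, MeasurableSpace (Ω i)] [MeasurableSpace Ω'] {μ : ∀ i, Measure (Ω i)}
    [∀ i, IsProbabilityMeasure (μ i)] {ν : Measure Ω'} [IsProbabilityMeasure ν] {l : Filter ι}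
    {X : ∀ i, Ω i → ℝ} (hX : ∀ i, Measurable (X i)) {Z : Ω' → ℝ} (hZ : Measurable Z) :
    TendstoInDistribution X l Z μ ν ↔ ∀ f : ℝ →ᵇ NNReal,
      Tendsto (fun i => ∫⁻ x, f (X i x) ∂(μ i)) l (𝓝 (∫⁻ x, f (Z x) ∂ν)) := by
  have hf : ∀ f : ℝ →ᵇ NNReal, Measurable fun x => (f x : ℝ≥0∞) :=
    fun f => f.continuous.measurable.coe_nnreal_ennreal
  have e : ∀ f : ℝ →ᵇ NNReal, Tendsto (fun i => ∫⁻ x, f x ∂((μ i).map (X i))) l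
      (𝓝 (∫⁻ x, f x ∂(ν.map Z))) ↔
      Tendsto (fun i => ∫⁻ x, f (X i x) ∂(μ i)) l (𝓝 (∫⁻ x, f (Z x) ∂ν)) := fun f => by
    simp_rw [lintegral_map (hf f) hZ, lintegral_map (hf f) (hX _)]
  constructor
  · intro h f
    exact (e f).1 (ProbabilityMeasure.tendsto_iff_forall_lintegral_tendsto.1 h.tendsto f)
  · intro h
    exact ⟨fun i => (hX i).aemeasurable, hZ.aemeasurable,
      ProbabilityMeasure.tendsto_iff_forall_lintegral_tendsto.2 fun f => (e f).2 (h f)⟩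

/-- Slutsky's theorem for products, for random variables on varying probability spaces. -/
theorem tendstoInDistribution_mul {ι : Type*} {Ω : ι → Type*} [∀ i, MeasurableSpace (Ω i)]
    {μ : ∀ i, Measure (Ω i)} [∀ i, IsProbabilityMeasure (μ i)] {ν : Measure ℝ}
    [IsProbabilityMeasure ν] {l : Filter ι} [l.IsCountablyGenerated] {X Y : ∀ i, Ω i → ℝ}
    (hX : ∀ i, Measurable (X i)) (hY : ∀ i, Measurable (Y i))
    (h : ∀ f : ℝ →ᵇ NNReal,
      Tendsto (fun i => ∫⁻ x, f (X i x) ∂(μ i)) l (𝓝 (∫⁻ s, f s ∂ν)))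
    (hc : ∀ ε : ℝ, 0 < ε → Tendsto (fun i => μ i {x | ε ≤ |Y i x - 1|}) l (𝓝 0)) :
    TendstoInDistribution (fun i x => X i x * Y i x) l (fun s => s) μ ν := by
  -- Slutsky's theorem is applied on one common space. Both hypotheses and the conclusion concern
  -- each index separately, so the infinite product of the `μ i` serves as a coupling.
  have hp : ∀ i, MeasurePreserving (Function.eval i) (Measure.infinitePi μ) (μ i) :=
    fun i => measurePreserving_eval_infinitePi μ i
  have hX' : TendstoInDistribution (fun i (ω : ∀ i, Ω i) => X i (ω i)) l (fun s => s)
      (fun _ => Measure.infinitePi μ) ν := by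
    refine (tendstoInDistribution_iff_lintegral
      (fun i => (hX i).comp (measurable_pi_apply i)) measurable_id).2 fun f => ?_
    refine (h f).congr fun i => ?_
    have hf : Measurable fun x => (f x : ℝ≥0∞) := f.continuous.measurable.coe_nnreal_ennreal
    exact ((hp i).lintegral_comp (hf.comp (hX i))).symm
  have hY' : TendstoInMeasure (Measure.infinitePi μ) (fun i (ω : ∀ i, Ω i) => Y i (ω i)) l
      (fun _ => (1 : ℝ)) := by
    rw [tendstoInMeasure_iff_norm]
    intro ε hε
    refine (hc ε hε).congr fun i => ?_
    rw [← (hp i).measure_preimage (measurableSet_le measurable_const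
      (((hY i).sub_const 1).abs)).nullMeasurableSet]
    rfl
  have hm := hX'.continuous_comp_prodMk_of_tendstoInMeasure_const
    (g := fun p : ℝ × ℝ => p.1 * p.2) (by fun_prop) hY'
    fun i => ((hY i).comp (measurable_pi_apply i)).aemeasurable
  have hXY : ∀ i, Measurable fun x => X i x * Y i x := fun i => (hX i).mul (hY i)
  refine (tendstoInDistribution_iff_lintegral hXY measurable_id).2 fun f => ?_
  have hf : Measurable fun x => (f x : ℝ≥0∞) := f.continuous.measurable.coe_nnreal_ennreal
  have := (tendstoInDistribution_iff_lintegral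
    (fun i => (hXY i).comp (measurable_pi_apply i)) (by fun_prop)).1 hm f
  simp only [mul_one] at this
  refine this.congr fun i => ?_
  exact (hp i).lintegral_comp (hf.comp (hXY i))

/-! ### Limit law of the direction of the configuration -/

/-- The rescaled magnetization of the direction of the spin configuration. -/
noncomputable def directionMagnetization (n : ℕ) (x : Fin n → ℝ) : ℝ :=
  √√(n : ℝ) * (magnetization n x / √(n : ℝ) / √(normSq x))

@[fun_prop]
theorem measurable_magnetization (n : ℕ) : Measurable (magnetization n) := by
  unfold magnetization; fun_prop

@[fun_prop]
theorem measurable_directionMagnetization (n : ℕ) : Measurable (directionMagnetization n) := by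
  unfold directionMagnetization; fun_prop

theorem temperature_eq (n : ℕ) (x : Fin n → ℝ) : temperature n x = normSq x / n := rfl

theorem diagForm_succ {d : ℕ} (a : Fin (d + 1) → ℝ) (y : Fin (d + 1) → ℝ) :
    diagForm a y = a 0 * y 0 ^ 2 + diagForm (fun k : Fin d => a k.succ) fun k : Fin d => y k.succ := by
  simp [diagForm, Fin.sum_univ_succ]

theorem normSq_succ {d : ℕ} (y : Fin (d + 1) → ℝ) :
    normSq y = y 0 ^ 2 + normSq fun k : Fin d => y k.succ := by
  simp [normSq, Fin.sum_univ_succ]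

theorem weight_hartley {d r : ℕ} (hr : r ≠ 0) {y : Fin (d + 1) → ℝ} (hy : y ≠ 0) :
    weight (d + 1) r ((hartley (d + 1)).mulVec y) =
      ENNReal.ofReal (Real.exp (((d : ℝ) + 1) / 2 *
        ((y 0 ^ 2 + diagForm (fun k : Fin d => eigenvalue (d + 1) r ((k : ℕ) + 1))
            fun k : Fin d => y k.succ) /
          (y 0 ^ 2 + normSq fun k : Fin d => y k.succ)))) := by
  have hd : (0 : ℝ) < (d : ℝ) + 1 := by positivity
  have hN : 0 < normSq y := normSq_pos hy
  have hT : temperature (d + 1) ((hartley (d + 1)).mulVec y) = normSq y / ((d : ℝ) + 1) := by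
    rw [temperature_eq, normSq_hartley]; push_cast; rfl
  have hpos : 0 < normSq y / ((d : ℝ) + 1) := div_pos hN hd
  rw [weight, hT, if_pos hpos, hamiltonian_hartley, diagForm_succ, ← normSq_succ]
  simp only [Fin.val_zero, Fin.val_succ, eigenvalue_zero hr]
  congr 2
  field_simp

/-- Hartley coordinates preserve Lebesgue measure and the norm, and split off `y 0`. The constant
does not depend on `f`, which is all that `tendsto_normalized` requires. -/
theorem exists_lintegral_directionMagnetization {d r : ℕ} (hd : d ≠ 0) (hr : r ≠ 0)
    (hl : ∀ k : Fin d, eigenvalue (d + 1) r ((k : ℕ) + 1) < 1) :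
    ∃ C : ℝ≥0∞, C ≠ 0 ∧ C ≠ ∞ ∧ ∀ f : ℝ → ℝ≥0∞, Measurable f →
      ∫⁻ x, f (directionMagnetization (d + 1) x) ∂(spinMeasure (d + 1) r) =
      C * ∫⁻ s, ENNReal.ofReal (slopeDensity d s) *
        (f (s / √(1 + s ^ 2 / √((d : ℝ) + 1))) *
          tiltMass (fun k : Fin d => eigenvalue (d + 1) r ((k : ℕ) + 1))
            (1 + s ^ 2 / √((d : ℝ) + 1))⁻¹) := by
  obtain ⟨C, hC0, hCt, hC⟩ := exists_lintegral_direction hd hl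
  set c : ℝ≥0∞ := ENNReal.ofReal (∏ _k : Fin (d + 1), √(1 : ℝ)) *
    ENNReal.ofReal (∏ _k : Fin (d + 1), (√(2 * Real.pi))⁻¹) with hc
  have hc0 : c ≠ 0 := by
    rw [hc]
    refine mul_ne_zero (ENNReal.ofReal_pos.2 ?_).ne' (ENNReal.ofReal_pos.2 ?_).ne'
    · simp
    · exact Finset.prod_pos fun k _ => by positivity
  have hct : c ≠ ∞ := ENNReal.mul_ne_top ENNReal.ofReal_ne_top ENNReal.ofReal_ne_top
  refine ⟨(partitionFunction (d + 1) r)⁻¹ * (c * C), ?_, ?_, fun f hf => ?_⟩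
  · exact mul_ne_zero (ENNReal.inv_ne_zero.2 (partitionFunction_ne_top _ _)) (mul_ne_zero hc0 hC0)
  · exact ENNReal.mul_ne_top (ENNReal.inv_ne_top.2 (partitionFunction_ne_zero _ _))
      (ENNReal.mul_ne_top hct hCt)
  have hw := measurable_weight (d + 1) r
  have hfD : Measurable fun x => f (directionMagnetization (d + 1) x) :=
    hf.comp (measurable_directionMagnetization _)
  have hmeas : Measurable fun p : ℝ × (Fin d → ℝ) =>
      f (√√((d : ℝ) + 1) * (p.1 / √(p.1 ^ 2 + normSq p.2))) *
        ENNReal.ofReal (Real.exp (((d : ℝ) + 1) / 2 *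
          ((p.1 ^ 2 + diagForm (fun k : Fin d => eigenvalue (d + 1) r ((k : ℕ) + 1)) p.2) /
            (p.1 ^ 2 + normSq p.2)))) *
        ENNReal.ofReal (Real.exp (-(p.1 ^ 2 + normSq p.2) / 2)) := by
    have h1 : Measurable fun p : ℝ × (Fin d → ℝ) =>
        √√((d : ℝ) + 1) * (p.1 / √(p.1 ^ 2 + normSq p.2)) := by fun_prop
    exact ((hf.comp h1).mul (by fun_prop)).mul (by fun_prop)
  rw [spinMeasure, lintegral_smul_measure, lintegral_withDensity_eq_lintegral_mul _ hw hfD,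
    ← precisionGaussian_one, lintegral_precisionGaussian fun _ => one_pos, ← hc, smul_eq_mul,
    mul_assoc (partitionFunction _ _)⁻¹, mul_assoc c, ← hC f hf,
    ← (volume_preserving_piFinSuccAbove (fun _ : Fin (d + 1) => ℝ) 0).lintegral_comp hmeas]
  have hG : Measurable fun x : Fin (d + 1) → ℝ =>
      (weight (d + 1) r * fun x => f (directionMagnetization (d + 1) x)) x *
        ENNReal.ofReal (Real.exp (-diagForm (fun _ => 1) x / 2)) :=
    (hw.mul hfD).mul (by fun_prop)
  rw [← (measurePreserving_hartley (n := d + 1)).lintegral_comp hG]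
  congr 2
  refine lintegral_congr_ae ?_
  filter_upwards [ae_ne_zero (Nat.succ_ne_zero d)] with y hy
  have hs : √((d : ℝ) + 1) ≠ 0 := by positivity
  simp only [Pi.mul_apply, weight_hartley hr hy, ← normSq_eq_diagForm, normSq_hartley,
    directionMagnetization, magnetization_hartley, MeasurableEquiv.piFinSuccAbove_apply,
    Fin.insertNthEquiv, Nat.cast_add, Nat.cast_one, mul_div_cancel_left₀ _ hs, normSq_succ y]
  simp [mul_comm (f _)]
  rfl

theorem lintegral_quarticLaw (f : ℝ → ℝ≥0∞) (hf : Measurable f) :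
    ∫⁻ s, f s ∂quarticLaw = ENNReal.ofReal (√2 / Real.Gamma (1 / 4)) *
      ∫⁻ s, ENNReal.ofReal (Real.exp (-(s ^ 4) / 4)) * f s := by
  have hG : 0 < Real.Gamma (1 / 4) := Real.Gamma_pos_of_pos (by norm_num)
  have hk : 0 ≤ √2 / Real.Gamma (1 / 4) := by positivity
  rw [quarticLaw, lintegral_withDensity_eq_lintegral_mul _ (by fun_prop) hf,
    ← lintegral_const_mul _ (by fun_prop)]
  refine lintegral_congr fun s => ?_
  rw [Pi.mul_apply, ENNReal.ofReal_mul hk, mul_assoc]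

/-- If the expectations of bounded continuous functions are, up to normalization, integrals
which converge, then they converge to the normalized limit. -/
theorem tendsto_normalized {J A : ℕ → (ℝ →ᵇ NNReal) → ℝ≥0∞} {C : ℕ → ℝ≥0∞}
    {J' A' : (ℝ →ᵇ NNReal) → ℝ≥0∞} {C' : ℝ≥0∞}
    (hC : ∀ᶠ d in atTop, ∀ f, A d f = C d * J d f) (h1 : ∀ d, A d 1 = 1)
    (hC' : ∀ f, A' f = C' * J' f) (h1' : A' 1 = 1) (hC0 : C' ≠ 0)
    (hJ : ∀ f, Tendsto (fun d => J d f) atTop (𝓝 (J' f))) (f : ℝ →ᵇ NNReal) :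
    Tendsto (fun d => A d f) atTop (𝓝 (A' f)) := by
  -- The condition that the test function 1 has mean 1 determines the constant as `a⁻¹`, so each
  -- expectation is a ratio of two convergent integrals.
  have e : ∀ {c a b : ℝ≥0∞}, c * a = 1 → c * b = b / a := fun h => by
    rw [ENNReal.eq_inv_of_mul_eq_one_left h, mul_comm, div_eq_mul_inv]
  have hJ1 : C' * J' 1 = 1 := by rw [← hC', h1']
  have hJ0 : J' 1 ≠ 0 := fun h => by simp [h] at hJ1
  have hJt : J' 1 ≠ ∞ := fun h => by simp [h, hC0] at hJ1
  rw [hC' f, e hJ1]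
  refine (ENNReal.Tendsto.div (hJ f) (.inr hJ0) (hJ 1) (.inl hJt)).congr' ?_
  filter_upwards [hC] with d hd
  rw [hd f, e (by rw [← hd, h1])]

theorem tendsto_lintegral_directionMagnetization {r : ℕ → ℕ}
    (hr : ∀ᶠ n : ℕ in atTop, 0 < 2 * r n ∧ 2 * r n < n)
    (hlim : Tendsto (fun n : ℕ => (r n : ℝ) / (n : ℝ) ^ (3 / 4 : ℝ)) atTop atTop)
    (f : ℝ →ᵇ NNReal) :
    Tendsto (fun n : ℕ => ∫⁻ x, f (directionMagnetization n x) ∂(spinMeasure n (r n))) atTop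
      (𝓝 (∫⁻ s, f s ∂quarticLaw)) := by
  have hs := spectralConditions_eigenvalue hr hlim
  have hm : ∀ f : ℝ →ᵇ NNReal, Measurable fun x => (f x : ℝ≥0∞) :=
    fun f => f.continuous.measurable.coe_nnreal_ennreal
  rw [← tendsto_add_atTop_iff_nat 1]
  have hex : ∀ᶠ d : ℕ in atTop, ∃ C : ℝ≥0∞, ∀ f : ℝ →ᵇ NNReal,
      ∫⁻ x, f (directionMagnetization (d + 1) x) ∂(spinMeasure (d + 1) (r (d + 1))) =
      C * ∫⁻ s, ENNReal.ofReal (slopeDensity d s) *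
        (f (s / √(1 + s ^ 2 / √((d : ℝ) + 1))) *
          tiltMass (fun k : Fin d => eigenvalue (d + 1) (r (d + 1)) ((k : ℕ) + 1))
            (1 + s ^ 2 / √((d : ℝ) + 1))⁻¹) := by
    filter_upwards [hs.lt_one, (tendsto_add_atTop_nat 1).eventually hr, eventually_ne_atTop 0]
      with d hl hd hd0
    obtain ⟨C, -, -, hC⟩ := exists_lintegral_directionMagnetization hd0 (r := r (d + 1))
      (by lia) hl
    exact ⟨C, fun f => hC _ (hm f)⟩
  obtain ⟨C, hC⟩ : ∃ C : ℕ → ℝ≥0∞, ∀ᶠ d : ℕ in atTop, ∀ f : ℝ →ᵇ NNReal,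
      ∫⁻ x, f (directionMagnetization (d + 1) x) ∂(spinMeasure (d + 1) (r (d + 1))) =
      C d * ∫⁻ s, ENNReal.ofReal (slopeDensity d s) *
        (f (s / √(1 + s ^ 2 / √((d : ℝ) + 1))) *
          tiltMass (fun k : Fin d => eigenvalue (d + 1) (r (d + 1)) ((k : ℕ) + 1))
            (1 + s ^ 2 / √((d : ℝ) + 1))⁻¹) := hex.choice
  have hG : 0 < Real.Gamma (1 / 4) := Real.Gamma_pos_of_pos (by norm_num)
  have hk : 0 < √2 / Real.Gamma (1 / 4) := by positivity
  exact tendsto_normalized (A' := fun f => ∫⁻ s, f s ∂quarticLaw)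
    (J' := fun f => ∫⁻ s, ENNReal.ofReal (Real.exp (-(s ^ 4) / 4)) * f s) hC (fun d => by simp)
    (fun f => lintegral_quarticLaw _ (hm f)) (by simp) (ENNReal.ofReal_pos.2 hk).ne'
    (fun f => hs.tendsto_lintegral f) f

/-! ### The norm of the configuration -/

theorem weight_smul (n r : ℕ) {t : ℝ} (ht : 0 < t) (x : Fin n → ℝ) :
    weight n r (t • x) = weight n r x := by
  have ht2 : 0 < t ^ 2 := by positivity
  have hT : temperature n (t • x) = t ^ 2 * temperature n x := by
    rw [temperature_eq, temperature_eq, normSq_smul, mul_div_assoc]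
  have hH : hamiltonian n r (t • x) = t ^ 2 * hamiltonian n r x := by
    have e : ∀ i : Fin n, ∀ j, (t • x) i * (t • x) (shift i j) = t ^ 2 * (x i * x (shift i j)) :=
      fun i j => by simp only [Pi.smul_apply, smul_eq_mul]; ring
    simp only [hamiltonian, e, ← Finset.mul_sum]
    ring
  simp only [weight, hT, hH, mul_pos_iff_of_pos_left ht2, ← mul_neg,
    mul_div_mul_left _ _ ht2.ne']

/-- Under the spin model the norm of the configuration has the same law as for free spins. -/
theorem spinMeasure_normSq_mem (n r : ℕ) [NeZero n] {s : Set ℝ} (hs : MeasurableSet s) :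
    spinMeasure n r {x | normSq x ∈ s} = freeMeasure n {x | normSq x ∈ s} := by
  have hm : MeasurableSet {x : Fin n → ℝ | normSq x ∈ s} := measurable_normSq hs
  have h := lintegral_mul_normSq (NeZero.ne n) (weight n r) (measurable_weight n r)
    (fun t ht x => weight_smul n r ht x) (s.indicator 1) (measurable_one.indicator hs)
  have e : (fun x : Fin n → ℝ => s.indicator (1 : ℝ → ℝ≥0∞) (normSq x)) =
      {x : Fin n → ℝ | normSq x ∈ s}.indicator 1 := by
    ext x; simp [Set.indicator]
  have e1 : ∀ x : Fin n → ℝ, weight n r x * s.indicator (1 : ℝ → ℝ≥0∞) (normSq x) =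
      {x : Fin n → ℝ | normSq x ∈ s}.indicator (weight n r) x := by
    intro x; simp [Set.indicator]
  rw [e, lintegral_indicator_one hm, lintegral_congr e1, lintegral_indicator hm] at h
  rw [spinMeasure, Measure.smul_apply, withDensity_apply _ hm, h, smul_eq_mul,
    ← partitionFunction, ← mul_assoc,
    ENNReal.inv_mul_cancel (partitionFunction_ne_zero n r) (partitionFunction_ne_top n r), one_mul]

theorem abs_sqrt_sub_one_le {u : ℝ} (hu : 0 ≤ u) : |√u - 1| ≤ |u - 1| := by
  have h : u - 1 = (√u - 1) * (√u + 1) := by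
    have := Real.mul_self_sqrt hu
    linear_combination -this
  rw [h, abs_mul, abs_of_pos (by positivity : 0 < √u + 1)]
  exact le_mul_of_one_le_right (abs_nonneg _) (by linarith [Real.sqrt_nonneg u])

/-- The law of the norm is that of free spins, so this is Chebyshev for a sum of `n` independent
squared Gaussians. The square root costs nothing, by `|√u - 1| ≤ |u - 1|`. -/
theorem spinMeasure_norm_deviation (n r : ℕ) [NeZero n] {ε : ℝ} (hε : 0 < ε) :
    spinMeasure n r {x | ε ≤ |√(normSq x / n) - 1|} ≤
      ENNReal.ofReal (Var[fun x => x ^ 2; gaussianReal 0 1] / ε ^ 2 / n) := by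
  have hn : (0 : ℝ) < n := by exact_mod_cast NeZero.pos n
  have hs : MeasurableSet {u : ℝ | ε ≤ |√(u / n) - 1|} :=
    measurableSet_le measurable_const (by fun_prop)
  refine (spinMeasure_normSq_mem n r hs).trans_le ?_
  have hdev := precisionGaussian_diagForm_deviation (a := fun _ : Fin n => 1)
    (fun _ => one_pos) (fun _ => 1) (mul_pos hε hn)
  rw [precisionGaussian_one] at hdev
  refine (measure_mono fun x hx => ?_).trans (hdev.trans (ENNReal.ofReal_le_ofReal ?_))
  · have hx' : ε ≤ |normSq x / n - 1| :=
      le_trans hx (abs_sqrt_sub_one_le (div_nonneg (normSq_nonneg x) hn.le))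
    have e : normSq x - n = (normSq x / n - 1) * n := by field_simp
    simp only [Set.mem_ofPred_eq, ← normSq_eq_diagForm, div_one, Finset.sum_const,
      Finset.card_univ, Fintype.card_fin, nsmul_eq_mul, mul_one]
    rw [e, abs_mul, abs_of_pos hn]
    exact mul_le_mul_of_nonneg_right hx' hn.le
  · simp only [div_one, one_pow, Finset.sum_const, Finset.card_univ, Fintype.card_fin,
      nsmul_eq_mul, mul_one]
    exact le_of_eq (by field_simp)

theorem tendsto_spinMeasure_norm_deviation (r : ℕ → ℕ) {ε : ℝ} (hε : 0 < ε) :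
    Tendsto (fun n : ℕ+ => spinMeasure n (r n) {x | ε ≤ |√(normSq x / (n : ℕ)) - 1|}) atTop
      (𝓝 0) := by
  have h : Tendsto (fun n : ℕ =>
      ENNReal.ofReal (Var[fun x => x ^ 2; gaussianReal 0 1] / ε ^ 2 / n)) atTop (𝓝 0) := by
    simpa using ENNReal.tendsto_ofReal (tendsto_const_div_atTop_nhds_zero_nat
      (Var[fun x => x ^ 2; gaussianReal 0 1] / ε ^ 2))
  exact tendsto_of_tendsto_of_tendsto_of_le_of_le tendsto_const_nhds
    (PNat.tendsto_comp_val_iff.2 h) (fun _ => zero_le)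
    fun n => spinMeasure_norm_deviation n (r n) hε

theorem directionMagnetization_mul {n : ℕ} (hn : n ≠ 0) (x : Fin n → ℝ) :
    directionMagnetization n x * √(normSq x / n) = magnetization n x / (n : ℝ) ^ (3 / 4 : ℝ) := by
  have hn' : (0 : ℝ) < n := by exact_mod_cast Nat.pos_of_ne_zero hn
  rcases eq_or_ne x 0 with rfl | hx
  · simp [directionMagnetization, magnetization]
  have hN : √(normSq x) ≠ 0 := (Real.sqrt_pos.2 (normSq_pos hx)).ne'
  have hq : √√(n : ℝ) ≠ 0 := by positivity
  have hq2 : √(n : ℝ) = √√(n : ℝ) ^ 2 := (Real.sq_sqrt (Real.sqrt_nonneg _)).symm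
  have hp : (n : ℝ) ^ (3 / 4 : ℝ) = √√(n : ℝ) ^ 3 := by
    rw [Real.sqrt_eq_rpow, Real.sqrt_eq_rpow, ← Real.rpow_mul hn'.le, ← Real.rpow_natCast,
      ← Real.rpow_mul hn'.le]
    norm_num
  rw [hp, directionMagnetization, Real.sqrt_div (normSq_nonneg x)]
  generalize √√(n : ℝ) = q at *
  rw [hq2]
  field_simp

end SpinChain

theorem theorem1 (r : ℕ → ℕ)
    (hr : ∀ᶠ n : ℕ in atTop, 0 < 2 * r n ∧ 2 * r n < n)
    (hlim : Tendsto (fun n : ℕ => (r n : ℝ) / (n : ℝ) ^ (3 / 4 : ℝ)) atTop atTop) :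
    TendstoInDistribution
      (fun (n : ℕ+) (x : Fin (n : ℕ) → ℝ) =>
        SpinChain.magnetization (n : ℕ) x / ((n : ℕ) : ℝ) ^ (3 / 4 : ℝ))
      atTop
      (fun x : ℝ => x)
      (fun n : ℕ+ => SpinChain.spinMeasure (n : ℕ) (r (n : ℕ)))
      SpinChain.quarticLaw := by
  -- The statistic is split into its direction part, which carries the limit law, and `√T_n`, which
  -- tends to 1 in probability.
  simp_rw [← SpinChain.directionMagnetization_mul (PNat.ne_zero _)]
  exact SpinChain.tendstoInDistribution_mul
    (fun n => SpinChain.measurable_directionMagnetization n)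
    (fun n => by fun_prop)
    (fun f => PNat.tendsto_comp_val_iff.2
      (SpinChain.tendsto_lintegral_directionMagnetization hr hlim f))
    fun ε hε => SpinChain.tendsto_spinMeasure_norm_deviation r hε
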